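/- Let $\Sigma$ be a finite set. For distributions on a finite set let $d(\mu,\nu)=\frac12\sum_x|\mu(x)-\nu(x)|$. Conditioning a distribution on a set $S\ne\emptyset$ of probability $0$ means, by convention, the uniform distribution on $S$. *Testers.* A conditional oracle for $\mu'$ on $\Sigma$ takes a nonempty set $B\subseteq\Sigma$ and returns a fresh independent sample of $\mu'$ conditioned on $B$. A subcube-conditional oracle for $\mu'$ on $\Sigma^n$ takes nonempty sets $A_1,\dots,A_n\subseteq\Sigma$ and returns a fresh independent sample of $\mu'$ conditioned on $A_1\times\dots\times A_n$. An $(\epsilon,\delta)$ (subcube-)conditional identity tester for a known distribution $\mu$ with sample complexity $t$ is a randomized adaptive algorithm that makes at most $t$ queries to the (subcube-)conditional oracle of an unknown distribution $\mu'$, accepts with probability at least $1-\delta$ if $\mu'=\mu$, and rejects with probability at least $1-\delta$ if $d(\mu',\mu)\ge\epsilon$. *Basic testers.* A basic tester with constants $(C,k)$ over $\Sigma$ is a family $T$ that gives, for every known distribution $\mu$ on $\Sigma$ and all $\epsilon,\delta\in(0,1)$, an $(\epsilon,\delta)$ conditional identity tester $T(\mu,\epsilon,\delta)$ for $\mu$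 with sample complexity at most $C f(1+\log f)^k$, where $f=(1+\log\frac1\delta)/\epsilon^2$ (that is, $\tilde O(\epsilon^{-2}\log\frac1\delta)$). *The joint tester.* Let $n\ge1$, $0<\epsilon\le1$, let $\mu$ be a known distribution on $\Sigma^n$, let $H(n)=\sum_{m=1}^n\frac1m$, and let $T$ be a basic tester over $\Sigma$. Put $\delta=\frac13$, $\epsilon'_j=\epsilon/(2^{j+1}H(n))$ and $\delta'=\delta\epsilon/(24n(\log_2 n+1)^2)$. For $j=1,\dots,\lfloor\log_2 n\rfloor+1$: sample $\lceil 4n/2^j\rceil$ elements of $[n]$ uniformly with replacement; for each sampled $i$, repeat $\lceil 3/\epsilon'_j\rceil$ times: draw $w\sim\mu$ and run $T(\mu_i|w^{(i-1)},\epsilon'_j,\delta')$, where $\mu_i|w^{(i-1)}$ is the law of $X_i$ for $X\sim\mu$ conditioned on $X_l=w_l$ for all $l<i$; a query $B\subseteq\Sigma$ of this run is answered with the $i$-th coordinate of a sample from the subcube-conditional oracle of the unknown $\mu'$ for $\{w_1\}\times\dots\times\{w_{i-1}\}\times B\times\Sigma\times\dots\times\Sigma$. If some run rejects, output REJECT;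 otherwise output ACCEPT at the end. **Theorem (identity tester for joint distributions).** 1. There are constants $C,k$ such that over every finite set $\Sigma$ there is a basic tester with constants $(C,k)$. 2. For all $C,k$ there are constants $C',k'$, depending only on $C,k$, such that for every finite $\Sigma$, every basic tester $T$ over $\Sigma$ with constants $(C,k)$, every $n\ge1$, every $0<\epsilon\le1$ and every known distribution $\mu$ on $\Sigma^n$, the joint tester is an $(\epsilon,\frac13)$ subcube-conditional identity tester for $\mu$ with sample complexity at most $$C'\,\frac{n^3}{\epsilon^3}\,\Bigl(1+\log n+\log\tfrac1\epsilon\Bigr)^{k'},$$ i.e. $\tilde O(n^3/\epsilon^3)$, where $\tilde O$ hides a polynomial in $\log n$ and $\log\frac1\epsilon$. -/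

import Mathlib

/-!
Randomized oracle algorithms, conditional and subcube-conditional sampling, distribution testers,
and the identity tester for joint distributions.
-/

/-- A randomized adaptive algorithm with oracle queries in `Q`, oracle answers in `R` and output
in `α`: it may stop, use internal randomness, or query the oracle and continue with the answer. -/
inductive Prog (Q R α : Type) : Type 1
  | pure (a : α) : Prog Q R α
  | sample {β : Type} (p : PMF β) (k : β → Prog Q R α) : Prog Q R α
  | query (q : Q) (k : R → Prog Q R α) : Prog Q R α

namespace Prog

variable {Q R α : Type}

/-- The output distribution, when each query `q` is answered by a fresh sample from `O q`. -/
noncomputable def run (O : Q → PMF R) : Prog Q R α → PMF α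
  | .pure a => PMF.pure a
  | .sample p k => p.bind fun b => run O (k b)
  | .query q k => (O q).bind fun r => run O (k r)

/-- On every branch at most `t` oracle queries are made. -/
def QueriesAtMost : Prog Q R α → ℕ → Prop
  | .pure _, _ => True
  | .sample _ k, t => ∀ b, QueriesAtMost (k b) t
  | .query _ _, 0 => False
  | .query _ k, t + 1 => ∀ r, QueriesAtMost (k r) t

/-- Run a tester; if it rejects (outputs `false`) then reject, otherwise continue with `next`. -/
def andThen : Prog Q R Bool → Prog Q R Bool → Prog Q R Bool
  | .pure true, next => next
  | .pure false, _ => .pure false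
  | .sample p k, next => .sample p fun b => andThen (k b) next
  | .query q k, next => .query q fun r => andThen (k r) next

/-- Run the listed testers one after the other, output REJECT (`false`) as soon as one of them
rejects, and output ACCEPT (`true`) at the end. -/
def allAccept : List (Prog Q R Bool) → Prog Q R Bool
  | [] => .pure true
  | p :: ps => andThen p (allAccept ps)

end Prog

/-- Total variation distance on a finite set. -/
noncomputable def tvDist {Ω : Type} [Fintype Ω] (μ ν : PMF Ω) : ℝ :=
  (1 / 2) * ∑ x, |(μ x).toReal - (ν x).toReal|

open Classical in
/-- `μ` conditioned on a nonempty set `S`; uniform on `S` if `μ S = 0`. -/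
noncomputable def condDist {Ω : Type} (μ : PMF Ω) (S : Finset Ω) (hS : S.Nonempty) : PMF Ω :=
  if h : ∃ a ∈ (S : Set Ω), a ∈ μ.support then μ.filter (S : Set Ω) h
  else PMF.uniformOfFinset S hS

/-- The conditions that may be submitted to a conditional oracle over `σ`. -/
def CondQuery (σ : Type) : Type := {B : Finset σ // B.Nonempty}

/-- The conditional sampling oracle. -/
noncomputable def condOracle {σ : Type} (μ : PMF σ) (B : CondQuery σ) : PMF σ :=
  condDist μ B.1 B.2

/-- The conditions `A₁ × ⋯ × Aₙ` that may be submitted to a subcube-conditional oracle. -/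
def SubcubeQuery (n : ℕ) (σ : Type) : Type := {A : Fin n → Finset σ // ∀ j, (A j).Nonempty}

/-- The subcube-conditional sampling oracle. -/
noncomputable def subCondOracle {n : ℕ} {σ : Type} (μ : PMF (Fin n → σ)) (A : SubcubeQuery n σ) :
    PMF (Fin n → σ) :=
  condDist μ (Fintype.piFinset A.1) (Fintype.piFinset_nonempty.2 A.2)

/-- `P` is an `(ε, δ)` tester for the property `prop` of distributions over `Ω`, with access to the
unknown distribution `μ` through the oracle `oracle μ`, with sample complexity `t`. -/
structure IsTester {Ω Q R : Type} [Fintype Ω] (oracle : PMF Ω → Q → PMF R) (prop : PMF Ω → Prop)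
    (ε δ : ℝ) (t : ℕ) (P : Prog Q R Bool) : Prop where
  complexity : P.QueriesAtMost t
  completeness : ∀ μ, prop μ → 1 - δ ≤ (P.run (oracle μ) true).toReal
  soundness : ∀ μ, (∀ ν, prop ν → ε ≤ tvDist μ ν) → 1 - δ ≤ (P.run (oracle μ) false).toReal

/-- `P` is an `(ε, δ)` conditional tester for identity to the known distribution `μ` over `σ`. -/
def IsCondIdentityTester {σ : Type} [Fintype σ] (μ : PMF σ) (ε δ : ℝ) (t : ℕ)
    (P : Prog (CondQuery σ) σ Bool) : Prop :=
  IsTester condOracle (fun ν => ν = μ) ε δ t P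

/-- `P` is an `(ε, δ)` subcube-conditional tester for identity to the known distribution `μ` over
`σⁿ`. -/
def IsSubCondIdentityTester {n : ℕ} {σ : Type} [Fintype σ] (μ : PMF (Fin n → σ)) (ε δ : ℝ) (t : ℕ)
    (P : Prog (SubcubeQuery n σ) (Fin n → σ) Bool) : Prop :=
  IsTester subCondOracle (fun ν => ν = μ) ε δ t P

/-- A program for each known distribution and each pair of parameters `ε`, `δ`. -/
abbrev IDTesterFamily (σ : Type) : Type 1 := PMF σ → ℝ → ℝ → Prog (CondQuery σ) σ Bool

/-- `T μ ε δ` is an `(ε, δ)` conditional identity tester for all `ε, δ ∈ (0, 1)` with sample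
complexity `Õ(f)`, `f = log (1 / δ) / ε ^ 2`, in the explicit form `C f (1 + log f) ^ k` (where
`log (1 / δ)` is replaced by `1 + log (1 / δ)` so that it does not vanish as `δ → 1`). -/
def IsBasicIDTester {σ : Type} [Fintype σ] (C : ℝ) (k : ℕ) (T : IDTesterFamily σ) : Prop :=
  ∀ (μ : PMF σ) (ε δ : ℝ), 0 < ε → ε < 1 → 0 < δ → δ < 1 →
    IsCondIdentityTester μ ε δ
      ⌊C * ((1 + Real.log (1 / δ)) / ε ^ 2) *
        (1 + Real.log ((1 + Real.log (1 / δ)) / ε ^ 2)) ^ k⌋₊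
      (T μ ε δ)

section Algorithm

variable {n : ℕ} {σ : Type} [Fintype σ]

/-- The subcube `{w₁} × ⋯ × {wᵢ₋₁} × B × σ × ⋯ × σ`, with `B` in position `i`. -/
def prefixCube (w : Fin n → σ) (i : Fin n) (B : CondQuery σ) : SubcubeQuery n σ :=
  ⟨fun j => if j < i then {w j} else if j = i then B.1 else Finset.univ, fun j => by
    dsimp only
    split_ifs
    · exact Finset.singleton_nonempty _
    · exact B.2
    · exact ⟨w j, Finset.mem_univ _⟩⟩

/-- The conditional marginal `μᵢ | w⁽ⁱ⁻¹⁾`: the law of `Xᵢ` for `X ∼ μ` given `Xⱼ = wⱼ` for all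
`j < i` (uniform on `σ` if this event has probability zero). -/
noncomputable def condMarginal (μ : PMF (Fin n → σ)) (i : Fin n) (w : Fin n → σ) : PMF σ :=
  (subCondOracle μ (prefixCube w i ⟨Finset.univ, ⟨w i, Finset.mem_univ _⟩⟩)).map fun x => x i

/-- Run a program written for a conditional oracle for `μ'ᵢ | w⁽ⁱ⁻¹⁾` with a subcube-conditional
oracle for `μ'`. -/
def simulate {α : Type} (w : Fin n → σ) (i : Fin n) :
    Prog (CondQuery σ) σ α → Prog (SubcubeQuery n σ) (Fin n → σ) α
  | .pure a => .pure a
  | .sample p k => .sample p fun b => simulate w i (k b)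
  | .query B k => .query (prefixCube w i B) fun x => simulate w i (k (x i))

/-- `ε' = ε / (2 ^ (j + 1) * H(n))`, where `H(n)` is the `n`-th harmonic number. -/
noncomputable def epsPrime (n : ℕ) (ε : ℝ) (j : ℕ) : ℝ := ε / (2 ^ (j + 1) * (harmonic n : ℝ))

/-- `δ' = δ * ε / (24 * n * (log₂ n + 1) ^ 2)`. -/
noncomputable def deltaPrime (n : ℕ) (ε δ : ℝ) : ℝ :=
  δ * ε / (24 * n * (Real.logb 2 n + 1) ^ 2)

/-- The identity tester for joint distributions with known distribution `μ`, distance parameter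
`ε`, `δ = 1 / 3`, and single-domain identity tester `T`. For `j = 1, …, ⌊log₂ n⌋ + 1` it draws
`⌈4 n / 2 ^ j⌉` coordinates uniformly with replacement; for each of them it repeats `⌈3 / ε'⌉` times:
draw `w ∼ μ` and run `T` on `μᵢ | w⁽ⁱ⁻¹⁾` with parameters `ε'` and `δ'`. -/
noncomputable def jointIdentityTester [NeZero n] (T : IDTesterFamily σ) (μ : PMF (Fin n → σ))
    (ε : ℝ) : Prog (SubcubeQuery n σ) (Fin n → σ) Bool :=
  Prog.allAccept <| (List.range' 1 (Nat.log 2 n + 1)).map fun j =>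
    Prog.sample (PMF.uniformOfFintype (Fin ⌈(4 * n / 2 ^ j : ℝ)⌉₊ → Fin n)) fun S =>
      Prog.allAccept <| (List.ofFn S).map fun i =>
        Prog.allAccept <| List.replicate ⌈3 / epsPrime n ε j⌉₊ <|
          Prog.sample μ fun w =>
            simulate w i (T (condMarginal μ i w) (epsPrime n ε j) (deltaPrime n ε (1 / 3)))

end Algorithm

/-! Joint tester. A run of `T` at coordinate `i` sees exactly the conditional oracle of the unknown
conditional marginal: restricting to a prefix cube and projecting to coordinate `i` commutes with
conditioning, zero-mass convention included (`map_subCondOracle`, `run_simulate`). Let x_i be the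
mean distance of the two conditional marginals at `i` over prefixes drawn from the known `μ`. The
distance d(μ, ν) is the `μ`-mean of max(1 - ν/μ, 0), and ν/μ is the product of the conditional
ratios, whence d(μ, ν) ≤ ∑ x_i (`tvDist_le_sum_condMarginal`). If the sum is at least ε, comparison
with the harmonic series yields m coordinates with x_i ≥ ε / (m H(n)) (`exists_card_le_of_le_sum`),
and the level whose scale matches m finds such a coordinate and a bad prefix often enough to reject.
If ν = μ, every run accepts with probability at least 1 - δ', so the tester accepts with probability
at least (1 - δ')^N, where N is the total number of runs.

Basic tester. Rank σ by increasing `μ`-mass. If ν is far from `μ`, then in total the proportions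
between elements y and the initial segments below them are wrong by a constant times ε
(`sum_abs_sub_le_sum_deviation`); segments of mass less than ε/2 can be ignored. A segment may be
much heavier than y, so it is cut into blocks of mass at most 2 μ(y), which is possible because none
of its elements is heavier than y. Inside y plus one block, y has `μ`-probability at least 1/3, and
its frequency is checked to precision t with about t⁻² samples, whatever the size of σ.

Pairs (y, block) must be drawn with probability at least proportional to their contribution. Half of
the time y is a sample of ν and the block is uniform; otherwise y has a known law κ and the block is
that of a sample of ν. The weights which κ has to dominate have only logarithmic total
(`sum_relWeight_le`), so a random pair has mean discrepancy at least ρ, of order ε / (1 + log(1/ε))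
(`le_pairExp`). Testing about 1/(2^j ρ) pairs at each dyadic precision 2^-j costs Õ(1/ρ²) queries
(`exists_weak_tester`), and a majority vote lowers the error to δ. -/

namespace Prog

/-! ### Acceptance probabilities and query counts of programs -/

variable {Q R α β : Type}

/-- The probability that a program with Boolean output accepts. -/
noncomputable def acc (O : Q → PMF R) (P : Prog Q R Bool) : ℝ := (P.run O true).toReal

lemma acc_nonneg (O : Q → PMF R) (P : Prog Q R Bool) : 0 ≤ acc O P := ENNReal.toReal_nonneg

lemma acc_le_one (O : Q → PMF R) (P : Prog Q R Bool) : acc O P ≤ 1 :=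
  ENNReal.toReal_le_of_le_ofReal zero_le_one (by simpa using PMF.coe_le_one _ _)

lemma run_false_eq (O : Q → PMF R) (P : Prog Q R Bool) :
    (P.run O false).toReal = 1 - acc O P := by
  have h := (P.run O).tsum_coe
  rw [tsum_bool] at h
  rw [acc, eq_sub_iff_add_eq, ← ENNReal.toReal_add (PMF.apply_ne_top _ _) (PMF.apply_ne_top _ _), h,
    ENNReal.toReal_one]

/-- Expectation over a finite distribution. -/
lemma toReal_bind_apply [Fintype α] (p : PMF α) (k : α → PMF β) (b : β) :
    ((p.bind k) b).toReal = ∑ a, (p a).toReal * (k a b).toReal := by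
  rw [PMF.bind_apply, tsum_fintype, ENNReal.toReal_sum]
  · simp
  · exact fun a _ => ENNReal.mul_ne_top (PMF.apply_ne_top _ _) (PMF.apply_ne_top _ _)

@[simp] lemma acc_pure_true (O : Q → PMF R) : acc O (.pure true) = 1 := by simp [acc, run]

@[simp] lemma acc_pure_false (O : Q → PMF R) : acc O (.pure false) = 0 := by simp [acc, run]

lemma acc_sample [Fintype β] (O : Q → PMF R) (p : PMF β) (k : β → Prog Q R Bool) :
    acc O (.sample p k) = ∑ b, (p b).toReal * acc O (k b) := by
  simp only [acc, run, toReal_bind_apply]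

lemma acc_query [Fintype R] (O : Q → PMF R) (q : Q) (k : R → Prog Q R Bool) :
    acc O (.query q k) = ∑ r, (O q r).toReal * acc O (k r) := by
  simp only [acc, run, toReal_bind_apply]

/-- Answers are fresh, so the two programs are independent and only the accepting branches of the
first reach the second. -/
lemma run_andThen_true (O : Q → PMF R) (P N : Prog Q R Bool) :
    (P.andThen N).run O true = P.run O true * N.run O true := by
  induction P with
  | pure a => cases a <;> simp [andThen, run]
  | sample p k ih => simp only [andThen, run, PMF.bind_apply, ih, ← mul_assoc, ENNReal.tsum_mul_right]
  | query q k ih => simp only [andThen, run, PMF.bind_apply, ih, ← mul_assoc, ENNReal.tsum_mul_right]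

lemma acc_andThen (O : Q → PMF R) (P N : Prog Q R Bool) :
    acc O (P.andThen N) = acc O P * acc O N := by
  simp [acc, run_andThen_true]

lemma acc_allAccept (O : Q → PMF R) (l : List (Prog Q R Bool)) :
    acc O (allAccept l) = (l.map (acc O)).prod := by
  induction l with
  | nil => simp [allAccept]
  | cons P l ih => simp [allAccept, acc_andThen, ih]

lemma acc_allAccept_replicate (O : Q → PMF R) (P : Prog Q R Bool) (m : ℕ) :
    acc O (allAccept (List.replicate m P)) = acc O P ^ m := by
  simp [acc_allAccept]

lemma QueriesAtMost.mono {P : Prog Q R α} {s t : ℕ} (h : P.QueriesAtMost s) (hst : s ≤ t) :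
    P.QueriesAtMost t := by
  induction P generalizing s t with
  | pure a => simp [QueriesAtMost]
  | sample p k ih => exact fun b => ih b (h b) hst
  | query q k ih =>
    cases s with
    | zero => exact h.elim
    | succ s =>
      cases t with
      | zero => omega
      | succ t => exact fun r => ih r (h r) (by omega)

/-- Sequential composition of programs. -/
def bind : Prog Q R α → (α → Prog Q R β) → Prog Q R β
  | .pure a, f => f a
  | .sample p k, f => .sample p fun b => bind (k b) f
  | .query q k, f => .query q fun r => bind (k r) f

lemma run_bind (O : Q → PMF R) (P : Prog Q R α) (f : α → Prog Q R β) :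
    (P.bind f).run O = (P.run O).bind fun a => (f a).run O := by
  induction P with
  | pure a => simp [bind, run]
  | sample p k ih => simp only [bind, run, ih, PMF.bind_bind]
  | query q k ih => simp only [bind, run, ih, PMF.bind_bind]

lemma acc_bind_bool (O : Q → PMF R) (P : Prog Q R Bool) (f : Bool → Prog Q R Bool) :
    acc O (P.bind f) = acc O P * acc O (f true) + (1 - acc O P) * acc O (f false) := by
  rw [acc, run_bind, toReal_bind_apply, Fintype.sum_bool, run_false_eq]
  rfl

lemma QueriesAtMost.bind {P : Prog Q R α} {f : α → Prog Q R β} {s t : ℕ}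
    (hP : P.QueriesAtMost s) (hf : ∀ a, (f a).QueriesAtMost t) :
    (P.bind f).QueriesAtMost (s + t) := by
  induction P generalizing s with
  | pure a => exact (hf a).mono (by omega)
  | sample p k ih => exact fun b => ih b (hP b)
  | query q k ih =>
    cases s with
    | zero => exact hP.elim
    | succ s =>
      rw [Nat.succ_add]
      exact fun r => ih r (hP r)

lemma QueriesAtMost.andThen {P N : Prog Q R Bool} {s t : ℕ}
    (hP : P.QueriesAtMost s) (hN : N.QueriesAtMost t) :
    (P.andThen N).QueriesAtMost (s + t) := by
  induction P generalizing s with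
  | pure a =>
    cases a
    · trivial
    · exact hN.mono (by omega)
  | sample p k ih => exact fun b => ih b (hP b)
  | query q k ih =>
    cases s with
    | zero => exact hP.elim
    | succ s =>
      rw [Nat.succ_add]
      exact fun r => ih r (hP r)

lemma QueriesAtMost.allAccept_map {ι : Type} {l : List ι} {P : ι → Prog Q R Bool} {t : ι → ℕ}
    (h : ∀ i ∈ l, (P i).QueriesAtMost (t i)) :
    (allAccept (l.map P)).QueriesAtMost (l.map t).sum := by
  induction l with
  | nil => trivial
  | cons i l ih =>
    simp only [List.map_cons, List.sum_cons, allAccept]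
    exact (h i (by simp)).andThen (ih fun j hj => h j (by simp [hj]))

lemma QueriesAtMost.allAccept_replicate {P : Prog Q R Bool} {t : ℕ} (h : P.QueriesAtMost t)
    (m : ℕ) : (allAccept (List.replicate m P)).QueriesAtMost (m * t) := by
  induction m with
  | zero => trivial
  | succ m ih =>
    rw [List.replicate_succ, allAccept, Nat.succ_mul, add_comm]
    exact h.andThen ih

/-! ### Repetition, Chernoff bounds, frequency tests and majority votes -/

/-- Run `P` for `m` times, add the number of acceptances to `c`, and apply `g` to the result. -/
def tally (P : Prog Q R Bool) (g : ℕ → Bool) : ℕ → ℕ → Prog Q R Bool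
  | 0, c => .pure (g c)
  | m + 1, c => P.bind fun b => tally P g m (c + b.toNat)

lemma QueriesAtMost.tally {P : Prog Q R Bool} {t : ℕ} (h : P.QueriesAtMost t) (g : ℕ → Bool)
    (m c : ℕ) : (tally P g m c).QueriesAtMost (m * t) := by
  induction m generalizing c with
  | zero => trivial
  | succ m ih =>
    rw [Nat.succ_mul, add_comm (m * t)]
    exact h.bind fun b => ih _

lemma acc_tally_not (O : Q → PMF R) (P : Prog Q R Bool) (g : ℕ → Bool) (m c : ℕ) :
    acc O (tally P (fun c => !g c) m c) = 1 - acc O (tally P g m c) := by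
  induction m generalizing c with
  | zero => cases h : g c <;> simp [tally, h]
  | succ m ih => simp only [tally, acc_bind_bool, ih]; ring

lemma acc_tally_or_le (O : Q → PMF R) (P : Prog Q R Bool) (g g' : ℕ → Bool) (m c : ℕ) :
    acc O (tally P (fun c => g c || g' c) m c) ≤
      acc O (tally P g m c) + acc O (tally P g' m c) := by
  induction m generalizing c with
  | zero => cases h : g c <;> cases h' : g' c <;> simp [tally, h, h']
  | succ m ih =>
    simp only [tally, acc_bind_bool]
    have h0 := acc_nonneg O P
    have h1 := acc_le_one O P
    have h2 := mul_le_mul_of_nonneg_left (ih (c + true.toNat)) h0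
    have h3 := mul_le_mul_of_nonneg_left (ih (c + false.toNat)) (sub_nonneg.2 h1)
    linarith

/-- Exponential moment bound for the number of acceptances. -/
lemma acc_tally_le (O : Q → PMF R) (P : Prog Q R Bool) (g : ℕ → Bool) {w z : ℝ} (hz : 0 ≤ z)
    (hw : 0 ≤ w) (hg : ∀ c, g c = true → 1 ≤ w * z ^ c) (m c : ℕ) :
    acc O (tally P g m c) ≤ w * z ^ c * (1 - acc O P + acc O P * z) ^ m := by
  induction m generalizing c with
  | zero =>
    cases h : g c
    · simp only [tally, h, acc_pure_false]; positivity
    · simpa [tally, h] using hg c h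
  | succ m ih =>
    simp only [tally, acc_bind_bool]
    have h0 := acc_nonneg O P
    have h1 := acc_le_one O P
    have h2 := mul_le_mul_of_nonneg_left (ih (c + true.toNat)) h0
    have h3 := mul_le_mul_of_nonneg_left (ih (c + false.toNat)) (sub_nonneg.2 h1)
    refine (add_le_add h2 h3).trans (le_of_eq ?_)
    simp only [Bool.toNat_true, Bool.toNat_false, add_zero]
    ring

/-- After centring, the linear terms of e^x ≤ 1 + x + x² (valid for |x| ≤ 1) cancel and the
quadratic ones sum to a(1 - a)s² ≤ s². -/
lemma bernoulli_mgf_le {a s : ℝ} (h0 : 0 ≤ a) (h1 : a ≤ 1) (hs : |s| ≤ 1) :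
    1 - a + a * Real.exp s ≤ Real.exp (s * a + s ^ 2) := by
  have key : (1 - a) * Real.exp (-(s * a)) + a * Real.exp (s * (1 - a)) ≤ Real.exp (s ^ 2) := by
    have e1 : |-(s * a)| ≤ 1 := by
      rw [abs_neg, abs_mul, abs_of_nonneg h0]; nlinarith [abs_nonneg s]
    have e2 : |s * (1 - a)| ≤ 1 := by
      rw [abs_mul, abs_of_nonneg (sub_nonneg.2 h1)]; nlinarith [abs_nonneg s]
    have b1 := (abs_le.1 (Real.abs_exp_sub_one_sub_id_le e1)).2
    have b2 := (abs_le.1 (Real.abs_exp_sub_one_sub_id_le e2)).2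
    have b3 := Real.add_one_le_exp (s ^ 2)
    have b4 := mul_le_mul_of_nonneg_left b1 (sub_nonneg.2 h1)
    have b5 := mul_le_mul_of_nonneg_left b2 h0
    have b6 : a * (1 - a) * s ^ 2 ≤ 1 * s ^ 2 :=
      mul_le_mul_of_nonneg_right (by nlinarith) (sq_nonneg s)
    nlinarith
  calc 1 - a + a * Real.exp s
      = Real.exp (s * a) * ((1 - a) * Real.exp (-(s * a)) + a * Real.exp (s * (1 - a))) := by
        have i1 : Real.exp (s * a) * Real.exp (-(s * a)) = 1 := by rw [← Real.exp_add]; simp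
        have i2 : Real.exp (s * a) * Real.exp (s * (1 - a)) = Real.exp s := by
          rw [← Real.exp_add]; ring_nf
        linear_combination (-(1 - a)) * i1 - a * i2
    _ ≤ Real.exp (s * a) * Real.exp (s ^ 2) := by gcongr
    _ = _ := by rw [← Real.exp_add]

/-- Chernoff bound: if `g` only accepts counts that exceed the mean by `m * t` in the direction
of the sign `u`, then it accepts with probability at most `exp (-m t² / 4)`. -/
lemma acc_tally_le_exp (O : Q → PMF R) (P : Prog Q R Bool) (g : ℕ → Bool) (m : ℕ) {u t : ℝ}
    (hu : |u| = 1) (ht0 : 0 ≤ t) (ht1 : t ≤ 1)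
    (hg : ∀ c : ℕ, g c = true → m * t ≤ u * (c - m * acc O P)) :
    acc O (tally P g m 0) ≤ Real.exp (-(m * t ^ 2 / 4)) := by
  set a := acc O P with ha
  have hu2 : u ^ 2 = 1 := by rw [← sq_abs, hu, one_pow]
  -- This tilt minimises the exponent -|s|mt + ms², with minimum -mt²/4.
  set s := u * t / 2 with hs
  have hs1 : |s| ≤ 1 := by
    rw [hs, abs_div, abs_mul, hu, abs_of_nonneg ht0, abs_two]; linarith
  have h := acc_tally_le O P g (w := Real.exp (-(s * (m * a) + m * t ^ 2 / 2)))
    (z := Real.exp s) (Real.exp_pos _).le (Real.exp_pos _).le (fun c hc => by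
      rw [← Real.exp_nat_mul, ← Real.exp_add]
      refine Real.one_le_exp ?_
      have := mul_le_mul_of_nonneg_right (hg c hc) (half_pos (zero_lt_one' ℝ)).le
      have := mul_le_mul_of_nonneg_right this ht0
      rw [hs]; nlinarith) m 0
  refine h.trans ?_
  rw [pow_zero, mul_one]
  have h2 : (1 - a + a * Real.exp s) ^ m ≤ Real.exp (s * a + s ^ 2) ^ m := by
    gcongr
    · have := acc_le_one O P
      have := acc_nonneg O P
      have := Real.exp_pos s
      have : 0 ≤ a * Real.exp s := by positivity
      linarith
    · exact bernoulli_mgf_le (acc_nonneg _ _) (acc_le_one _ _) hs1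
  refine (mul_le_mul_of_nonneg_left h2 (Real.exp_pos _).le).trans ?_
  rw [← Real.exp_nat_mul, ← Real.exp_add, Real.exp_le_exp]
  have : s ^ 2 = t ^ 2 / 4 := by rw [hs]; linear_combination (t ^ 2 / 4) * hu2
  rw [this]; nlinarith

/-- The test that accepts if the empirical frequency of acceptance of `P` in `m` runs is at
distance less than `t` from `b`. -/
noncomputable def freqTest (P : Prog Q R Bool) (b t : ℝ) (m : ℕ) : Prog Q R Bool :=
  tally P (fun c => decide (|(c : ℝ) - m * b| < m * t)) m 0

lemma one_sub_acc_freqTest_le (O : Q → PMF R) (P : Prog Q R Bool) {b t : ℝ} (m : ℕ)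
    (ht0 : 0 ≤ t) (ht1 : t ≤ 1) (hb : acc O P = b) :
    1 - acc O (freqTest P b t m) ≤ 2 * Real.exp (-(m * t ^ 2 / 4)) := by
  rw [freqTest, ← acc_tally_not]
  have e : (fun c : ℕ => !decide (|(c : ℝ) - m * b| < m * t)) =
      fun c : ℕ => decide (m * t ≤ 1 * ((c : ℝ) - m * b)) ||
        decide (m * t ≤ (-1) * ((c : ℝ) - m * b)) := by
    funext c
    rw [← decide_not, ← Bool.decide_or, decide_eq_decide, not_lt, le_abs, one_mul, neg_one_mul]
  rw [e]
  refine (acc_tally_or_le _ _ _ _ _ _).trans ?_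
  rw [two_mul]
  subst hb
  exact add_le_add
    (acc_tally_le_exp O P _ m (u := 1) (by simp) ht0 ht1 fun c hc => of_decide_eq_true hc)
    (acc_tally_le_exp O P _ m (u := -1) (by simp) ht0 ht1 fun c hc => of_decide_eq_true hc)

/-- When the mean is off by at least 2t, a frequency within t of `b` still deviates from the mean by
t; only one tail is involved, on the side of `b`. -/
lemma acc_freqTest_le (O : Q → PMF R) (P : Prog Q R Bool) {b t : ℝ} (m : ℕ)
    (ht0 : 0 ≤ t) (ht1 : t ≤ 1) (hb : 2 * t ≤ |acc O P - b|) :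
    acc O (freqTest P b t m) ≤ Real.exp (-(m * t ^ 2 / 4)) := by
  have hm : (0 : ℝ) ≤ m := m.cast_nonneg
  rcases le_abs.1 hb with h | h
  · refine acc_tally_le_exp O P _ m (u := -1) (by simp) ht0 ht1 fun c hc => ?_
    have := (abs_lt.1 (of_decide_eq_true hc)).2
    nlinarith
  · refine acc_tally_le_exp O P _ m (u := 1) (by simp) ht0 ht1 fun c hc => ?_
    have := (abs_lt.1 (of_decide_eq_true hc)).1
    nlinarith

/-- Majority vote over `m` runs. -/
noncomputable def majority (P : Prog Q R Bool) (m : ℕ) : Prog Q R Bool :=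
  tally P (fun c => decide ((m : ℝ) / 2 < c)) m 0

/-- A wrong majority is a deviation of 2/3 - 1/2 = 1/6 from the mean, and (1/6)²/4 = 1/144. -/
lemma one_sub_acc_majority_le (O : Q → PMF R) (P : Prog Q R Bool) (m : ℕ)
    (h : 2 / 3 ≤ acc O P) : 1 - acc O (majority P m) ≤ Real.exp (-(m / 144)) := by
  have hm : (0 : ℝ) ≤ m := m.cast_nonneg
  rw [majority, ← acc_tally_not]
  refine (acc_tally_le_exp O P _ m (u := -1) (t := 1 / 6) (by simp) (by norm_num) (by norm_num)
    fun c hc => ?_).trans (by rw [Real.exp_le_exp]; linarith)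
  simp only [Bool.not_eq_true', decide_eq_false_iff_not, not_lt] at hc
  nlinarith

lemma acc_majority_le (O : Q → PMF R) (P : Prog Q R Bool) (m : ℕ)
    (h : acc O P ≤ 1 / 3) : acc O (majority P m) ≤ Real.exp (-(m / 144)) := by
  have hm : (0 : ℝ) ≤ m := m.cast_nonneg
  refine (acc_tally_le_exp O P _ m (u := 1) (t := 1 / 6) (by simp) (by norm_num) (by norm_num)
    fun c hc => ?_).trans (by rw [Real.exp_le_exp]; linarith)
  simp only [decide_eq_true_eq] at hc
  nlinarith

end Prog

/-! ### Point masses of conditional distributions and their images -/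

lemma PMF.sum_toReal {Ω : Type} [Fintype Ω] (μ : PMF Ω) : ∑ x, (μ x).toReal = 1 := by
  rw [← ENNReal.toReal_sum fun a _ => PMF.apply_ne_top _ _, ← tsum_fintype (L := .unconditional Ω), μ.tsum_coe,
    ENNReal.toReal_one]

lemma PMF.ext_toReal {Ω : Type} {μ ν : PMF Ω} (h : ∀ x, (μ x).toReal = (ν x).toReal) : μ = ν :=
  PMF.ext fun x => (ENNReal.toReal_eq_toReal_iff' (μ.apply_ne_top x) (ν.apply_ne_top x)).1 (h x)

open Classical in
lemma PMF.map_toReal {Ω Ω' : Type} [Fintype Ω] (μ : PMF Ω) (f : Ω → Ω') (b : Ω') :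
    (μ.map f b).toReal = ∑ x with f x = b, (μ x).toReal := by
  rw [PMF.map, Prog.toReal_bind_apply, Finset.sum_filter]
  refine Finset.sum_congr rfl fun x _ => ?_
  by_cases h : f x = b
  · simp [h]
  · simp [h, PMF.pure_apply, Ne.symm h]

open Classical in
/-- The point masses of a conditional distribution. -/
lemma condDist_toReal {Ω : Type} (μ : PMF Ω) (S : Finset Ω) (hS : S.Nonempty) (x : Ω) :
    (condDist μ S hS x).toReal = if x ∈ S then
      (if ∑ y ∈ S, (μ y).toReal = 0 then 1 / (S.card : ℝ)
        else (μ x).toReal / ∑ y ∈ S, (μ y).toReal) else 0 := by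
  have hsum : ∑ y ∈ S, (μ y).toReal = (∑ y ∈ S, μ y).toReal :=
    (ENNReal.toReal_sum fun a _ => μ.apply_ne_top a).symm
  have hfin : ∑ y ∈ S, μ y ≠ ⊤ := ENNReal.sum_ne_top.2 fun a _ => μ.apply_ne_top a
  have hind : ∑' y, (S : Set Ω).indicator μ y = ∑ y ∈ S, μ y := by
    rw [← Finset.tsum_subtype', tsum_subtype]
  by_cases h : ∃ a ∈ (S : Set Ω), a ∈ μ.support
  · have h0 : ∑ y ∈ S, μ y ≠ 0 := by
      obtain ⟨a, ha, hs⟩ := h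
      exact fun h0 => (μ.mem_support_iff a).1 hs (Finset.sum_eq_zero_iff.1 h0 a ha)
    rw [condDist, dif_pos h, PMF.filter_apply, hind, hsum,
      if_neg (show ¬ (∑ y ∈ S, μ y).toReal = 0 by rw [ENNReal.toReal_eq_zero_iff]; tauto)]
    by_cases hx : x ∈ S
    · rw [if_pos hx, Set.indicator_of_mem (by simpa using hx), ENNReal.toReal_mul,
        ENNReal.toReal_inv, div_eq_mul_inv]
    · rw [if_neg hx, Set.indicator_of_notMem (by simpa using hx)]; simp
  · have h0 : ∑ y ∈ S, (μ y).toReal = 0 := by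
      refine Finset.sum_eq_zero fun a ha => ?_
      by_contra h1
      exact h ⟨a, ha, (μ.mem_support_iff a).2 fun h2 => h1 (by rw [h2, ENNReal.toReal_zero])⟩
    rw [condDist, dif_neg h, if_pos h0, PMF.uniformOfFinset_apply]
    split_ifs <;> simp

open Classical in
/-- Conditioning commutes with a map all of whose fibres have the same size. -/
lemma condDist_filter_map {Ω Ω' : Type} [Fintype Ω] [Fintype Ω'] (μ : PMF Ω) (f : Ω → Ω')
    (S S' : Finset Ω) (B : Finset Ω') (hS : S.Nonempty) (hS' : S'.Nonempty) (hB : B.Nonempty)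
    (h : ∀ x, x ∈ S' ↔ x ∈ S ∧ f x ∈ B) (c : ℕ) (hc : ∀ b, (S.filter fun x => f x = b).card = c) :
    (condDist μ S' hS').map f = condDist ((condDist μ S hS).map f) B hB := by
  set F : Ω' → ℝ := fun b => ∑ x ∈ S with f x = b, (μ x).toReal with hF
  have hF0 : ∀ b, 0 ≤ F b := fun b => Finset.sum_nonneg fun x _ => ENNReal.toReal_nonneg
  have hSF : ∑ x ∈ S, (μ x).toReal = ∑ b, F b := by
    exact (Finset.sum_fiberwise S f fun x => (μ x).toReal).symm
  have hS'e : S' = S.filter fun x => f x ∈ B := by ext x; simp [h]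
  have hfib : ∀ b ∈ B, (S'.filter fun x => f x = b) = S.filter fun x => f x = b := by
    intro b hb; ext x; simp only [Finset.mem_filter, h]
    constructor
    · tauto
    · rintro ⟨h1, rfl⟩; tauto
  have hmaps : ∀ x ∈ S', f x ∈ B := fun x hx => ((h x).1 hx).2
  have hS'F : ∑ x ∈ S', (μ x).toReal = ∑ b ∈ B, F b := by
    rw [← Finset.sum_fiberwise_of_maps_to hmaps]
    exact Finset.sum_congr rfl fun b hb => by rw [hfib b hb]
  have hcS : S.card = Fintype.card Ω' * c := by
    rw [Finset.card_eq_sum_card_fiberwise (t := Finset.univ) (f := f) (fun _ _ => Finset.mem_univ _),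
      Finset.sum_congr rfl fun b _ => hc b]
    simp
  have hcS' : S'.card = B.card * c := by
    rw [Finset.card_eq_sum_card_fiberwise (t := B) (f := f) hmaps,
      Finset.sum_congr rfl fun b hb => by rw [hfib b hb, hc b]]
    simp
  have hc0 : (c : ℝ) ≠ 0 := by
    have := hS.card_pos
    rw [hcS] at this
    exact Nat.cast_ne_zero.2 (Nat.pos_of_mul_pos_left this).ne'
  have hΩ' : (Fintype.card Ω' : ℝ) ≠ 0 := by
    have := hS.card_pos
    rw [hcS] at this
    exact Nat.cast_ne_zero.2 (Nat.pos_of_mul_pos_right this).ne'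
  have hBc : (B.card : ℝ) ≠ 0 := Nat.cast_ne_zero.2 hB.card_pos.ne'
  have hmap : ∀ (U : Finset Ω) (hU : U.Nonempty) (b : Ω'), ((condDist μ U hU).map f b).toReal =
      if ∑ y ∈ U, (μ y).toReal = 0 then ((U.filter fun x => f x = b).card : ℝ) / U.card
      else (∑ x ∈ U with f x = b, (μ x).toReal) / ∑ y ∈ U, (μ y).toReal := by
    intro U hU b
    simp only [PMF.map_toReal, condDist_toReal]
    rw [← Finset.sum_filter, Finset.filter_filter]
    have : (Finset.univ.filter fun x => f x = b ∧ x ∈ U) = U.filter fun x => f x = b := by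
      ext x; simp [and_comm]
    rw [this]
    split_ifs
    · simp [div_eq_mul_inv]
    · rw [Finset.sum_div]
  refine PMF.ext_toReal fun b => ?_
  rw [condDist_toReal, hmap S' hS']
  simp only [hmap S hS, hc]
  by_cases hb : b ∈ B
  swap
  · have : (S'.filter fun x => f x = b) = ∅ := by
      ext x; simp only [Finset.mem_filter, h, Finset.notMem_empty, iff_false]
      rintro ⟨⟨_, h1⟩, rfl⟩; exact hb h1
    simp [this, hb]
  rw [if_pos hb, hfib b hb, hS'F, hSF, hcS, hcS', hc]
  have hFe : ∀ b, ∑ x ∈ S with f x = b, (μ x).toReal = F b := fun b => rfl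
  clear_value F
  simp only [hFe]
  -- Three cases: `S` has mass zero, only `S'` has mass zero, neither has. In the first two both
  -- sides are uniform on `B`, and this is where equal fibre sizes are needed.
  by_cases h0 : ∑ b, F b = 0
  · have hz : ∀ b, F b = 0 := fun b =>
      (Finset.sum_eq_zero_iff_of_nonneg fun b _ => hF0 b).1 h0 b (Finset.mem_univ _)
    simp only [hz, Finset.sum_const_zero, if_true, Finset.sum_const, nsmul_eq_mul, Nat.cast_mul]
    rw [if_neg (mul_ne_zero hBc (div_ne_zero hc0 (mul_ne_zero hΩ' hc0)))]
    field_simp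
  · simp only [if_neg h0, ← Finset.sum_div]
    by_cases h1 : ∑ b ∈ B, F b = 0
    · rw [if_pos h1, h1, zero_div, if_pos rfl, Nat.cast_mul]; field_simp
    · rw [if_neg h1, if_neg (div_ne_zero h1 h0)]; field_simp

/-! ### Prefix cubes and conditional marginals -/

section Subcube

variable {n : ℕ} {σ : Type} [Fintype σ]

lemma mem_prefixCube (w : Fin n → σ) (i : Fin n) (B : CondQuery σ) (x : Fin n → σ) :
    x ∈ Fintype.piFinset (prefixCube w i B).1 ↔ (∀ j < i, x j = w j) ∧ x i ∈ B.1 := by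
  simp only [Fintype.mem_piFinset, prefixCube]
  constructor
  · refine fun h => ⟨fun j hj => ?_, ?_⟩
    · have := h j; rwa [if_pos hj, Finset.mem_singleton] at this
    · have := h i; rwa [if_neg (lt_irrefl i), if_pos rfl] at this
  · rintro ⟨h1, h2⟩ j
    split_ifs with h3 h4
    · simpa using h1 j h3
    · rwa [h4]
    · simp

lemma mem_prefixCube_univ (w : Fin n → σ) (i : Fin n) (h : (Finset.univ : Finset σ).Nonempty)
    (x : Fin n → σ) :
    x ∈ Fintype.piFinset (prefixCube w i ⟨Finset.univ, h⟩).1 ↔ ∀ j < i, x j = w j :=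
  (mem_prefixCube w i ⟨Finset.univ, h⟩ x).trans (and_iff_left (Finset.mem_univ _))

-- The fibres are boxes with free coordinates exactly after `i`, so their size does not depend on
-- `b`, as `condDist_filter_map` requires.
open Classical in
lemma card_prefixCube_fiber (w : Fin n → σ) (i : Fin n) (B : CondQuery σ) (hB : B.1 = Finset.univ)
    (b : σ) : ((Fintype.piFinset (prefixCube w i B).1).filter fun x => x i = b).card =
      ∏ j, if i < j then Fintype.card σ else 1 := by
  have : ((Fintype.piFinset (prefixCube w i B).1).filter fun x => x i = b) =
      Fintype.piFinset fun j => if i < j then Finset.univ else if j = i then {b} else {w j} := by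
    ext x
    rw [Finset.mem_filter, mem_prefixCube, hB, Fintype.mem_piFinset]
    constructor
    · rintro ⟨⟨h1, _⟩, h2⟩ j
      split_ifs with h3 h4
      · simp
      · simp [h4, h2]
      · simpa using h1 j (lt_of_le_of_ne (not_lt.1 h3) h4)
    · refine fun h => ⟨⟨fun j hj => ?_, Finset.mem_univ _⟩, ?_⟩
      · have := h j
        rwa [if_neg hj.not_gt, if_neg hj.ne, Finset.mem_singleton] at this
      · have := h i
        rwa [if_neg (lt_irrefl i), if_pos rfl, Finset.mem_singleton] at this
  rw [this, Fintype.card_piFinset]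
  refine Finset.prod_congr rfl fun j _ => ?_
  split_ifs <;> simp

/-- A coordinate of a sample from the subcube-conditional oracle for a prefix cube is a sample
from the conditional oracle of the conditional marginal. -/
lemma map_subCondOracle (μ : PMF (Fin n → σ)) (w : Fin n → σ) (i : Fin n) (B : CondQuery σ) :
    (subCondOracle μ (prefixCube w i B)).map (fun x => x i) = condOracle (condMarginal μ i w) B := by
  classical
  refine condDist_filter_map μ (fun x => x i) _ _ B.1 _ _ B.2 (fun x => ?_) _
    (card_prefixCube_fiber w i _ rfl)
  exact (mem_prefixCube w i B x).trans
    (and_congr_left fun _ => (mem_prefixCube_univ w i _ x).symm)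

/-- Here `μ` plays the unknown distribution. Prefixes of probability zero under it need no separate
treatment, so `T` may be applied for every `w`. -/
lemma run_simulate {α : Type} (μ : PMF (Fin n → σ)) (w : Fin n → σ) (i : Fin n)
    (P : Prog (CondQuery σ) σ α) :
    (simulate w i P).run (subCondOracle μ) = P.run (condOracle (condMarginal μ i w)) := by
  induction P with
  | pure a => rfl
  | sample p k ih => simp only [simulate, Prog.run, ih]
  | query q k ih =>
    simp only [simulate, Prog.run, ih, ← map_subCondOracle, PMF.bind_map]
    rfl

lemma queriesAtMost_simulate {α : Type} (w : Fin n → σ) (i : Fin n)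
    {P : Prog (CondQuery σ) σ α} {t : ℕ} (h : P.QueriesAtMost t) :
    (simulate w i P).QueriesAtMost t := by
  induction P generalizing t with
  | pure a => trivial
  | sample p k ih => exact fun b => ih b (h b)
  | query q k ih =>
    cases t with
    | zero => exact h.elim
    | succ t => exact fun r => ih (r i) (h (r i))

open Classical in
/-- The probability that a sample agrees with `w` in the coordinates before `i`. -/
noncomputable def prefixMass (μ : PMF (Fin n → σ)) (i : ℕ) (w : Fin n → σ) : ℝ :=
  ∑ x with ∀ j : Fin n, (j : ℕ) < i → x j = w j, (μ x).toReal

open Classical in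
lemma condMarginal_toReal (μ : PMF (Fin n → σ)) (i : Fin n) (w : Fin n → σ)
    (h : prefixMass μ i w ≠ 0) (b : σ) : (condMarginal μ i w b).toReal =
      (∑ x with (∀ j < i, x j = w j) ∧ x i = b, (μ x).toReal) / prefixMass μ i w := by
  have hmem : ∀ x, x ∈ Fintype.piFinset (prefixCube w i ⟨Finset.univ, ⟨w i, Finset.mem_univ _⟩⟩).1 ↔
      ∀ j < i, x j = w j := mem_prefixCube_univ w i _
  have hm : ∑ x ∈ Fintype.piFinset (prefixCube w i ⟨Finset.univ, ⟨w i, Finset.mem_univ _⟩⟩).1,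
      (μ x).toReal = prefixMass μ i w := by
    refine Finset.sum_congr ?_ fun _ _ => rfl
    ext x; rw [hmem]; simp
  rw [condMarginal, PMF.map_toReal]
  simp only [subCondOracle, condDist_toReal, hm, if_neg h, hmem]
  rw [← Finset.sum_filter, Finset.filter_filter, Finset.sum_div]
  refine Finset.sum_congr ?_ fun _ _ => rfl
  ext x; simp [and_comm]

end Subcube

/-! ### Total variation distance and the chain rule -/

lemma tvDist_eq_sum_max {Ω : Type} [Fintype Ω] (μ ν : PMF Ω) :
    tvDist μ ν = ∑ x, max ((μ x).toReal - (ν x).toReal) 0 := by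
  have h : ∀ a b : ℝ, |a - b| = 2 * max (a - b) 0 - (a - b) := fun a b => by
    rcases le_total a b with h | h
    · rw [abs_of_nonpos (by linarith), max_eq_right (by linarith)]; ring
    · rw [abs_of_nonneg (by linarith), max_eq_left (by linarith)]; ring
  simp only [tvDist, h, Finset.sum_sub_distrib, ← Finset.mul_sum, PMF.sum_toReal]
  ring

lemma tvDist_comm {Ω : Type} [Fintype Ω] (μ ν : PMF Ω) : tvDist μ ν = tvDist ν μ := by
  simp only [tvDist, abs_sub_comm]

lemma tvDist_le_one {Ω : Type} [Fintype Ω] (μ ν : PMF Ω) : tvDist μ ν ≤ 1 := by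
  rw [tvDist_eq_sum_max, ← PMF.sum_toReal μ]
  exact Finset.sum_le_sum fun x _ => max_le (sub_le_self _ ENNReal.toReal_nonneg)
    ENNReal.toReal_nonneg

/-- With the `r i` as conditional likelihood ratios, this splits the loss of the joint ratio into
losses of single coordinates. A factor above 1 only lowers the left side; a factor below 1 costs at
most 1 - `r i`. -/
lemma one_sub_prod_le {ι : Type} (s : Finset ι) (r : ι → ℝ) (hr : ∀ i, 0 ≤ r i) :
    1 - ∏ i ∈ s, r i ≤ ∑ i ∈ s, max (1 - r i) 0 := by
  classical
  induction s using Finset.induction_on with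
  | empty => simp
  | insert a s ha ih =>
    rw [Finset.prod_insert ha, Finset.sum_insert ha]
    have hP : 0 ≤ ∏ i ∈ s, r i := Finset.prod_nonneg fun i _ => hr i
    rcases le_total 1 (r a) with h | h
    · have := le_max_right (1 - r a) 0
      nlinarith
    · have := le_max_left (1 - r a) 0
      have : 0 ≤ ∑ i ∈ s, max (1 - r i) 0 := Finset.sum_nonneg fun i _ => le_max_right _ _
      have := hr a
      nlinarith [mul_le_mul_of_nonneg_left ih (hr a)]

section Chain

variable {n : ℕ} {σ : Type} [Fintype σ]

lemma condMarginal_congr (μ : PMF (Fin n → σ)) (i : Fin n) {w x : Fin n → σ}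
    (h : ∀ j < i, x j = w j) : condMarginal μ i x = condMarginal μ i w := by
  have e : prefixCube x i ⟨Finset.univ, ⟨x i, Finset.mem_univ _⟩⟩ =
      prefixCube w i ⟨Finset.univ, ⟨w i, Finset.mem_univ _⟩⟩ := by
    refine Subtype.ext (funext fun j => ?_)
    simp only [prefixCube]
    split_ifs with h1
    · rw [h j h1]
    · rfl
    · rfl
  rw [condMarginal, e, condMarginal]

lemma prefixMass_zero (μ : PMF (Fin n → σ)) (w : Fin n → σ) : prefixMass μ 0 w = 1 := by
  simp [prefixMass, PMF.sum_toReal]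

lemma prefixMass_self (μ : PMF (Fin n → σ)) (w : Fin n → σ) :
    prefixMass μ n w = (μ w).toReal := by
  classical
  rw [prefixMass, Finset.sum_eq_single_of_mem w (by simp)]
  intro x hx hne
  exact absurd (funext fun j => (Finset.mem_filter.1 hx).2 j j.2) hne

lemma prefixMass_nonneg (μ : PMF (Fin n → σ)) (i : ℕ) (w : Fin n → σ) : 0 ≤ prefixMass μ i w :=
  Finset.sum_nonneg fun _ _ => ENNReal.toReal_nonneg

lemma toReal_le_prefixMass (μ : PMF (Fin n → σ)) (i : ℕ) (w : Fin n → σ) :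
    (μ w).toReal ≤ prefixMass μ i w := by
  classical
  exact Finset.single_le_sum (f := fun x => (μ x).toReal) (fun _ _ => ENNReal.toReal_nonneg)
    (by simp)

open Classical in
lemma prefixMass_succ_eq_sum (μ : PMF (Fin n → σ)) (i : Fin n) (w : Fin n → σ) :
    prefixMass μ (i + 1) w = ∑ x with (∀ j < i, x j = w j) ∧ x i = w i, (μ x).toReal := by
  refine Finset.sum_congr ?_ fun _ _ => rfl
  ext x
  simp only [Finset.mem_filter, Finset.mem_univ, true_and]
  constructor
  · exact fun h => ⟨fun j hj => h j (Nat.lt_succ_of_lt hj), h i (Nat.lt_succ_self _)⟩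
  · rintro ⟨h1, h2⟩ j hj
    rcases Nat.lt_succ_iff_lt_or_eq.1 hj with h | h
    · exact h1 j h
    · rw [Fin.ext h, h2]

lemma prefixMass_succ_le (μ : PMF (Fin n → σ)) (i : Fin n) (w : Fin n → σ) :
    prefixMass μ (i + 1) w ≤ prefixMass μ i w := by
  classical
  refine Finset.sum_le_sum_of_subset_of_nonneg (fun x hx => ?_) fun _ _ _ => ENNReal.toReal_nonneg
  simp only [Finset.mem_filter, Finset.mem_univ, true_and] at hx ⊢
  exact fun j hj => hx j (by omega)

lemma prefixMass_succ (μ : PMF (Fin n → σ)) (i : Fin n) (w : Fin n → σ) :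
    prefixMass μ (i + 1) w = prefixMass μ i w * (condMarginal μ i w (w i)).toReal := by
  by_cases h : prefixMass μ i w = 0
  · rw [h, zero_mul]
    exact le_antisymm (h ▸ prefixMass_succ_le μ i w) (prefixMass_nonneg _ _ _)
  · rw [condMarginal_toReal μ i w h, mul_div_cancel₀ _ h, prefixMass_succ_eq_sum]

/-- The chain rule for point masses. -/
lemma toReal_eq_prod_condMarginal (μ : PMF (Fin n → σ)) (w : Fin n → σ) :
    (μ w).toReal = ∏ i, (condMarginal μ i w (w i)).toReal := by
  have key : ∀ k ≤ n, prefixMass μ k w =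
      ∏ i : Fin n, if (i : ℕ) < k then (condMarginal μ i w (w i)).toReal else 1 := by
    intro k
    induction k with
    | zero => intro _; simp [prefixMass_zero]
    | succ k ih =>
      intro hk
      have h1 := prefixMass_succ μ ⟨k, hk⟩ w
      rw [ih (by omega)] at h1
      rw [h1, ← Finset.prod_erase_mul _ _ (Finset.mem_univ (⟨k, hk⟩ : Fin n)),
        ← Finset.prod_erase_mul _ _ (Finset.mem_univ (⟨k, hk⟩ : Fin n))]
      simp only [lt_irrefl, if_false, mul_one, Nat.lt_succ_self, if_true]
      congr 1
      refine Finset.prod_congr rfl fun i hi => ?_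
      have : (i : ℕ) ≠ k := fun h => (Finset.mem_erase.1 hi).1 (Fin.ext h)
      simp only [Nat.lt_succ_iff_lt_or_eq, this, or_false]
  have := key n le_rfl
  rw [prefixMass_self] at this
  simpa using this

/-- Resampling coordinate `i` from its conditional law does not change expectations of functions of
the first `i` coordinates. -/
lemma sum_condMarginal (μ : PMF (Fin n → σ)) (i : Fin n) (ψ : (Fin n → σ) → σ → ℝ)
    (hψ : ∀ w x : Fin n → σ, (∀ j < i, x j = w j) → ψ x = ψ w) :
    ∑ w, (μ w).toReal * ∑ b, (condMarginal μ i w b).toReal * ψ w b =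
      ∑ w, (μ w).toReal * ψ w (w i) := by
  classical
  have hQ : ∀ w x : Fin n → σ, (∀ j < i, x j = w j) → prefixMass μ i x = prefixMass μ i w := by
    intro w x h
    refine Finset.sum_congr ?_ fun _ _ => rfl
    ext y
    simp only [Finset.mem_filter, Finset.mem_univ, true_and]
    exact forall₂_congr fun j hj => by rw [h j hj]
  -- Expanding the conditional law gives a sum over pairs `w`, `x` with a common prefix. The prefix
  -- mass depends only on that prefix, so summing over `w` first cancels it.
  have h1 : ∀ w, (μ w).toReal * ∑ b, (condMarginal μ i w b).toReal * ψ w b =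
      ∑ x, if ∀ j < i, x j = w j then
        (μ w).toReal / prefixMass μ i w * ((μ x).toReal * ψ x (x i)) else 0 := by
    intro w
    by_cases hw : prefixMass μ i w = 0
    · have : (μ w).toReal = 0 :=
        le_antisymm (hw ▸ toReal_le_prefixMass μ i w) ENNReal.toReal_nonneg
      simp [this]
    · rw [← Finset.sum_filter, ← Finset.mul_sum, ← Finset.sum_fiberwise _ (fun x : Fin n → σ => x i),
        div_mul_eq_mul_div, mul_div_assoc, Finset.sum_div]
      congr 1
      refine Finset.sum_congr rfl fun b _ => ?_
      rw [condMarginal_toReal μ i w hw, div_mul_eq_mul_div, Finset.sum_mul, Finset.filter_filter]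
      congr 1
      refine Finset.sum_congr rfl fun x hx => ?_
      obtain ⟨hx1, hx2⟩ := (Finset.mem_filter.1 hx).2
      rw [hψ w x hx1, hx2]
  rw [Finset.sum_congr rfl fun w _ => h1 w, Finset.sum_comm]
  refine Finset.sum_congr rfl fun x _ => ?_
  by_cases hx : prefixMass μ i x = 0
  · have : (μ x).toReal = 0 :=
      le_antisymm (hx ▸ toReal_le_prefixMass μ i x) ENNReal.toReal_nonneg
    simp [this]
  · have h2 : ∀ w, (if ∀ j < i, x j = w j then
        (μ w).toReal / prefixMass μ i w * ((μ x).toReal * ψ x (x i)) else 0) =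
        (if ∀ j : Fin n, (j : ℕ) < i → w j = x j then (μ w).toReal else 0) *
          (((μ x).toReal * ψ x (x i)) / prefixMass μ i x) := by
      intro w
      by_cases h : ∀ j < i, x j = w j
      · rw [if_pos h, if_pos (show ∀ j : Fin n, (j : ℕ) < i → w j = x j from
          fun j hj => (h j hj).symm), hQ w x h]; ring
      · rw [if_neg h, if_neg (show ¬ ∀ j : Fin n, (j : ℕ) < i → w j = x j from
          fun h' => h fun j hj => (h' j hj).symm), zero_mul]
    rw [Finset.sum_congr rfl fun w _ => h2 w, ← Finset.sum_mul, ← Finset.sum_filter]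
    exact mul_div_cancel₀ _ hx

/-- The distance of two joint distributions is at most the sum of the expected distances of their
conditional marginals. -/
lemma tvDist_le_sum_condMarginal (μ ν : PMF (Fin n → σ)) :
    tvDist μ ν ≤ ∑ i, ∑ w, (μ w).toReal * tvDist (condMarginal μ i w) (condMarginal ν i w) := by
  -- Division by zero gives the value 1 where the point mass of the conditional marginal of `μ`
  -- vanishes; this is harmless since `ψ` is always weighted by that mass or by `μ`.
  set ψ : Fin n → (Fin n → σ) → σ → ℝ := fun i w b =>
    max (1 - (condMarginal ν i w b).toReal / (condMarginal μ i w b).toReal) 0 with hψ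
  have h1 : ∀ i w, tvDist (condMarginal μ i w) (condMarginal ν i w) =
      ∑ b, (condMarginal μ i w b).toReal * ψ i w b := by
    intro i w
    rw [tvDist_eq_sum_max]
    refine Finset.sum_congr rfl fun b _ => ?_
    rcases (ENNReal.toReal_nonneg (a := condMarginal μ i w b)).eq_or_lt with h | h
    · rw [← h, zero_mul, zero_sub, max_eq_right (neg_nonpos.2 ENNReal.toReal_nonneg)]
    · rw [hψ, mul_max_of_nonneg _ _ h.le, mul_zero, mul_sub, mul_one, mul_div_cancel₀ _ h.ne']
  have h2 : ∀ i, ∑ w, (μ w).toReal * tvDist (condMarginal μ i w) (condMarginal ν i w) =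
      ∑ w, (μ w).toReal * ψ i w (w i) := fun i => by
    rw [← sum_condMarginal μ i (ψ i) fun w x h => by
      simp only [hψ, condMarginal_congr μ i h, condMarginal_congr ν i h]]
    exact Finset.sum_congr rfl fun w _ => by rw [h1]
  rw [Finset.sum_congr rfl fun i _ => h2 i, Finset.sum_comm, tvDist_eq_sum_max]
  refine Finset.sum_le_sum fun w _ => ?_
  rw [← Finset.mul_sum]
  have hs : 0 ≤ ∑ i, ψ i w (w i) := Finset.sum_nonneg fun i _ => le_max_right _ _
  rcases (ENNReal.toReal_nonneg (a := μ w)).eq_or_lt with h | h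
  · rw [← h, zero_mul, zero_sub, max_eq_right (neg_nonpos.2 ENNReal.toReal_nonneg)]
  · refine max_le ?_ (by positivity)
    have h3 := one_sub_prod_le Finset.univ
      (fun i => (condMarginal ν i w (w i)).toReal / (condMarginal μ i w (w i)).toReal)
      fun i => by positivity
    rw [Finset.prod_div_distrib, ← toReal_eq_prod_condMarginal, ← toReal_eq_prod_condMarginal] at h3
    have h4 := mul_le_mul_of_nonneg_left h3 h.le
    rwa [mul_sub, mul_one, mul_div_cancel₀ _ h.ne'] at h4

end Chain

/-! ### Many large coordinates from a large sum -/

/-- If `x₁ + ⋯ + xₙ ≥ ε`, then for some `m` at least `m` of the numbers are at least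
`ε / (m H(n))`. -/
lemma exists_card_le_of_le_sum {n : ℕ} (hn : 0 < n) (x : Fin n → ℝ) {ε : ℝ} (h : ε ≤ ∑ i, x i) :
    ∃ m : ℕ, 1 ≤ m ∧ m ≤ n ∧
      m ≤ (Finset.univ.filter fun i => ε / (m * (harmonic n : ℝ)) ≤ x i).card := by
  by_contra hcon
  push Not at hcon
  -- In decreasing order, failure for m = k + 1 bounds the entry at index k (counted from 0)
  -- strictly by ε / ((k + 1) H(n)); these bounds add up to ε.
  set s := Tuple.sort fun i => -x i
  have hs : Monotone ((fun i => -x i) ∘ s) := Tuple.monotone_sort _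
  have hlt : ∀ k : Fin n, x (s k) < ε / (((k : ℕ) + 1 : ℕ) * (harmonic n : ℝ)) := by
    intro k
    by_contra hk
    rw [not_lt] at hk
    refine absurd (hcon (k + 1) (by omega) (by omega)) (not_lt.2 ?_)
    calc (k : ℕ) + 1 = ((Finset.Iic k).image s).card := by
          rw [Finset.card_image_of_injective _ s.injective, Fin.card_Iic]
      _ ≤ _ := Finset.card_le_card fun i hi => by
          obtain ⟨l, hl, rfl⟩ := Finset.mem_image.1 hi
          refine Finset.mem_filter.2 ⟨Finset.mem_univ _, hk.trans ?_⟩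
          have := hs (Finset.mem_Iic.1 hl)
          simp only [Function.comp] at this
          linarith
  have hH : (harmonic n : ℝ) = ∑ k : Fin n, (((k : ℕ) + 1 : ℕ) : ℝ)⁻¹ := by
    rw [harmonic, Finset.sum_range]; push_cast; rfl
  have hHpos : (0 : ℝ) < harmonic n := by exact_mod_cast harmonic_pos hn.ne'
  have : ∑ i, x i < ε := by
    rw [← Equiv.sum_comp s]
    calc ∑ k, x (s k) < ∑ k : Fin n, ε / (((k : ℕ) + 1 : ℕ) * (harmonic n : ℝ)) :=
          Finset.sum_lt_sum_of_nonempty ⟨⟨0, hn⟩, Finset.mem_univ _⟩ fun k _ => hlt k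
      _ = ε / harmonic n * ∑ k : Fin n, (((k : ℕ) + 1 : ℕ) : ℝ)⁻¹ := by
          rw [Finset.mul_sum]
          exact Finset.sum_congr rfl fun k _ => by rw [mul_comm, ← div_div, div_eq_mul_inv _ (_ : ℝ)]
      _ = ε := by rw [← hH, div_mul_cancel₀ _ hHpos.ne']
  linarith

lemma List.prod_map_range' (f : ℕ → ℝ) (J : ℕ) :
    ((List.range' 1 J).map f).prod = ∏ j ∈ Finset.range J, f (j + 1) := by
  induction J with
  | zero => simp
  | succ J ih =>
    rw [List.range'_1_concat, List.map_append, List.prod_append, ih, Finset.prod_range_succ]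
    simp [add_comm]

lemma List.sum_map_range' (f : ℕ → ℕ) (J : ℕ) :
    ((List.range' 1 J).map f).sum = ∑ j ∈ Finset.range J, f (j + 1) := by
  induction J with
  | zero => simp
  | succ J ih =>
    rw [List.range'_1_concat, List.map_append, List.sum_append, ih, Finset.sum_range_succ]
    simp [add_comm]

/-! ### Acceptance probability and query count of the joint tester -/

/-- The number of sampled coordinates at a level. -/
noncomputable def numCoords (n j : ℕ) : ℕ := ⌈(4 * n / 2 ^ j : ℝ)⌉₊

/-- The number of repetitions for each sampled coordinate at a level. -/
noncomputable def numReps (n : ℕ) (ε : ℝ) (j : ℕ) : ℕ := ⌈3 / epsPrime n ε j⌉₊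

section Joint

variable {n : ℕ} {σ : Type} [Fintype σ]

/-- The acceptance probability of a run of `T` at coordinate `i`. -/
noncomputable def runAcc (T : IDTesterFamily σ) (μ ν : PMF (Fin n → σ)) (ε' δ' : ℝ) (i : Fin n) :
    ℝ :=
  ∑ w, (μ w).toReal * Prog.acc (condOracle (condMarginal ν i w)) (T (condMarginal μ i w) ε' δ')

/-- All draws are independent, so everything factors: repetitions at one coordinate give a power,
independent uniform coordinates give a power of an average (by expanding the power of a sum), and
levels multiply. -/
lemma acc_jointIdentityTester [NeZero n] (T : IDTesterFamily σ) (μ ν : PMF (Fin n → σ)) (ε : ℝ) :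
    Prog.acc (subCondOracle ν) (jointIdentityTester T μ ε) =
      ∏ j ∈ Finset.range (Nat.log 2 n + 1),
        ((∑ i, runAcc T μ ν (epsPrime n ε (j + 1)) (deltaPrime n ε (1 / 3)) i ^
          numReps n ε (j + 1)) / n) ^ numCoords n (j + 1) := by
  rw [jointIdentityTester, Prog.acc_allAccept, List.map_map, List.prod_map_range']
  refine Finset.prod_congr rfl fun j _ => ?_
  rw [Function.comp, Prog.acc_sample, div_pow, Fintype.sum_pow, Finset.sum_div]
  refine Finset.sum_congr rfl fun S _ => ?_
  rw [Prog.acc_allAccept, List.map_map, ← List.prod_ofFn, List.map_ofFn, PMF.uniformOfFintype_apply,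
    div_eq_inv_mul _ ((n : ℝ) ^ _)]
  congr 1
  · simp [numCoords]
  · congr 2
    funext k
    simp only [Function.comp, Prog.acc_allAccept_replicate, Prog.acc_sample, runAcc, numReps]
    congr 1
    refine Finset.sum_congr rfl fun w _ => ?_
    rw [Prog.acc, run_simulate, Prog.acc]

lemma queriesAtMost_jointIdentityTester [NeZero n] (T : IDTesterFamily σ) (μ : PMF (Fin n → σ))
    (ε : ℝ) (t : ℕ → ℕ) (h : ∀ (j : ℕ) (m : PMF σ), 1 ≤ j →
      (T m (epsPrime n ε j) (deltaPrime n ε (1 / 3))).QueriesAtMost (t j)) :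
    (jointIdentityTester T μ ε).QueriesAtMost (∑ j ∈ Finset.range (Nat.log 2 n + 1),
      numCoords n (j + 1) * (numReps n ε (j + 1) * t (j + 1))) := by
  rw [jointIdentityTester, ← List.sum_map_range' fun j => numCoords n j * (numReps n ε j * t j)]
  refine Prog.QueriesAtMost.allAccept_map fun j hj S => ?_
  have hj1 : 1 ≤ j := by
    rw [List.mem_range'_1] at hj; exact hj.1
  refine (Prog.QueriesAtMost.allAccept_map (t := fun _ => numReps n ε j * t j)
    fun i _ => Prog.QueriesAtMost.allAccept_replicate (fun w => ?_) _).mono (le_of_eq ?_)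
  · exact queriesAtMost_simulate w i (h j _ hj1)
  · simp only [List.map_const', List.length_ofFn, List.sum_replicate, smul_eq_mul]
    rfl

end Joint

/-! ### Numerical estimates for the parameters -/

section Parameters

variable {n : ℕ}

lemma one_le_harmonic (hn : 1 ≤ n) : (1 : ℝ) ≤ harmonic n := by
  have : harmonic 1 ≤ harmonic n := by
    rw [harmonic, harmonic]
    exact Finset.sum_le_sum_of_subset_of_nonneg (Finset.range_mono hn) fun _ _ _ => by positivity
  rw [harmonic_succ, harmonic_zero] at this
  exact_mod_cast (by norm_num at this; exact this : (1 : ℚ) ≤ harmonic n)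

lemma harmonic_le_log (n : ℕ) : (harmonic n : ℝ) ≤ 1 + Real.log n := by
  exact_mod_cast harmonic_le_one_add_log n

lemma epsPrime_pos (hn : 1 ≤ n) {ε : ℝ} (h0 : 0 < ε) (j : ℕ) : 0 < epsPrime n ε j := by
  have := one_le_harmonic hn
  unfold epsPrime
  positivity

lemma epsPrime_lt_one (hn : 1 ≤ n) {ε : ℝ} (h1 : ε ≤ 1) (j : ℕ) :
    epsPrime n ε j < 1 := by
  have h := one_le_harmonic hn
  have h2 : (2 : ℝ) ≤ 2 ^ (j + 1) := by
    rw [pow_succ]; linarith [one_le_pow₀ (one_le_two (α := ℝ)) (n := j)]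
  rw [epsPrime, div_lt_one (by positivity)]
  nlinarith

lemma logb_two_nonneg (hn : 1 ≤ n) : 0 ≤ Real.logb 2 n :=
  Real.logb_nonneg one_lt_two (by exact_mod_cast hn)

lemma deltaPrime_pos (hn : 1 ≤ n) {ε : ℝ} (h0 : 0 < ε) : 0 < deltaPrime n ε (1 / 3) := by
  have h := logb_two_nonneg hn
  have : (1 : ℝ) ≤ n := by exact_mod_cast hn
  unfold deltaPrime
  positivity

lemma deltaPrime_le (hn : 1 ≤ n) {ε : ℝ} (h1 : ε ≤ 1) : deltaPrime n ε (1 / 3) ≤ 1 / 72 := by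
  have h := logb_two_nonneg hn
  have hn' : (1 : ℝ) ≤ n := by exact_mod_cast hn
  rw [deltaPrime, div_le_iff₀ (by positivity)]
  have : 1 ≤ (n : ℝ) * (Real.logb 2 n + 1) ^ 2 := by
    have : 1 ≤ (Real.logb 2 n + 1) ^ 2 := by nlinarith
    nlinarith
  nlinarith

lemma natLog_le_logb (n : ℕ) : (Nat.log 2 n : ℝ) ≤ Real.logb 2 n := by
  exact_mod_cast Real.natLog_le_logb n 2

end Parameters

/-- The ceilings in the numbers of runs can push `N * δ` above 1/3, so a union bound is too weak.
Since 1/(1 - δ) ≤ 1 + (72/71)δ, the power is at least exp(-0.3854), which exceeds 2/3. -/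
lemma two_thirds_le_one_sub_pow {δ : ℝ} (h0 : 0 ≤ δ) (h1 : δ ≤ 1 / 72) {N : ℕ}
    (h : N * δ ≤ 0.38) : 2 / 3 ≤ (1 - δ) ^ N := by
  have hδ : 0 < 1 - δ := by linarith
  have e1 : Real.exp (-(δ * (72 / 71))) ≤ 1 - δ := by
    rw [Real.exp_neg, inv_le_comm₀ (Real.exp_pos _) hδ]
    refine le_trans ?_ (Real.add_one_le_exp _)
    rw [inv_le_iff_one_le_mul₀ hδ]
    nlinarith
  have e2 : Real.exp (0.3854 / 4) ^ 4 ≤ 3 / 2 := by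
    have := (abs_le.1 (Real.abs_exp_sub_one_sub_id_le (x := 0.3854 / 4) (by norm_num [abs_le]))).2
    calc Real.exp (0.3854 / 4) ^ 4 ≤ (1.10564 : ℝ) ^ 4 := by
          gcongr; norm_num at this ⊢; linarith
      _ ≤ 3 / 2 := by norm_num
  rw [← Real.exp_nat_mul] at e2
  calc (2 / 3 : ℝ) = (3 / 2)⁻¹ := by norm_num
    _ ≤ (Real.exp ((4 : ℕ) * (0.3854 / 4)))⁻¹ := inv_anti₀ (Real.exp_pos _) e2
    _ ≤ Real.exp (-(δ * (72 / 71))) ^ N := by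
      rw [← Real.exp_nat_mul, ← Real.exp_neg, Real.exp_le_exp]
      push_cast; nlinarith
    _ ≤ _ := by gcongr

lemma sum_inv_two_pow_le (J : ℕ) : ∑ j ∈ Finset.range J, (1 / 2 ^ (j + 1) : ℝ) ≤ 1 := by
  have : ∑ j ∈ Finset.range J, (1 / 2 ^ (j + 1) : ℝ) = 1 - 1 / 2 ^ J := by
    induction J with
    | zero => simp
    | succ J ih => rw [Finset.sum_range_succ, ih]; field_simp; ring
  rw [this]
  have : (0 : ℝ) < 1 / 2 ^ J := by positivity
  linarith

lemma sum_two_pow_le (J : ℕ) : ∑ j ∈ Finset.range J, (2 ^ (j + 1) : ℝ) ≤ 2 ^ (J + 1) := by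
  have : ∑ j ∈ Finset.range J, (2 ^ (j + 1) : ℝ) = 2 ^ (J + 1) - 2 := by
    induction J with
    | zero => simp
    | succ J ih => rw [Finset.sum_range_succ, ih]; ring
  linarith

lemma two_pow_natLog_succ_le {n : ℕ} (hn : 1 ≤ n) : (2 : ℝ) ^ (Nat.log 2 n + 1) ≤ 2 * n := by
  rw [pow_succ, mul_comm]
  have : 2 ^ Nat.log 2 n ≤ n := Nat.pow_log_le_self 2 (by omega)
  have : (2 : ℝ) ^ Nat.log 2 n ≤ n := by exact_mod_cast this
  linarith

/-- The bracket bounds ε times the number of repetitions, and 27.36 = 72 · 0.38. The estimate for n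
≥ 4 uses log₂ n ≥ 2; smaller n are computed directly. -/
lemma sum_numCoords_mul_le {n : ℕ} (hn : 1 ≤ n) :
    ∑ j ∈ Finset.range (Nat.log 2 n + 1),
      (numCoords n (j + 1) : ℝ) * (6 * 2 ^ (j + 1) * (harmonic n : ℝ) + 1) ≤
      27.36 * n * (Real.logb 2 n + 1) ^ 2 := by
  have hn' : (1 : ℝ) ≤ n := by exact_mod_cast hn
  have hH1 := one_le_harmonic hn
  have hL := natLog_le_logb n
  have hL0 := logb_two_nonneg hn
  rcases lt_or_ge n 4 with h4 | h4
  · have hc : ∀ a b c : ℕ, 4 * a ≤ b * 2 ^ c → numCoords a c ≤ b := by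
      intro a b c h
      rw [numCoords, Nat.ceil_le, div_le_iff₀ (by positivity)]
      exact_mod_cast h
    interval_cases n
    · have h1 : (numCoords 1 1 : ℝ) ≤ 2 := mod_cast hc 1 2 1 (by norm_num)
      norm_num [harmonic]
      linarith
    · have h1 : (numCoords 2 1 : ℝ) ≤ 4 := mod_cast hc 2 4 1 (by norm_num)
      have h2 : (numCoords 2 2 : ℝ) ≤ 2 := mod_cast hc 2 2 2 (by norm_num)
      have l2 : Nat.log 2 2 = 1 := by decide
      have b2 : Real.logb 2 2 = 1 := Real.logb_self_eq_one one_lt_two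
      rw [l2]
      norm_num [harmonic, Finset.sum_range_succ, b2]
      linarith
    · have h1 : (numCoords 3 1 : ℝ) ≤ 6 := mod_cast hc 3 6 1 (by norm_num)
      have h2 : (numCoords 3 2 : ℝ) ≤ 3 := mod_cast hc 3 3 2 (by norm_num)
      have l2 : Nat.log 2 3 = 1 := by decide
      rw [l2] at hL ⊢
      norm_num [harmonic, Finset.sum_range_succ] at hL ⊢
      nlinarith
  · set J := Nat.log 2 n + 1 with hJ
    set H := (harmonic n : ℝ)
    set L := Real.logb 2 n
    have hH2 : H ≤ 1 + 0.7 * L := by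
      have : Real.log n = Real.log 2 * L := by
        rw [mul_comm]; exact (div_eq_iff (Real.log_pos one_lt_two).ne').1 rfl
      have h3 := harmonic_le_log n
      rw [this] at h3
      have := Real.log_two_lt_d9
      nlinarith
    have hL2 : 2 ≤ L := by
      rw [Real.le_logb_iff_rpow_le one_lt_two (by linarith)]
      norm_num
      exact_mod_cast h4
    have hJn : (J : ℝ) ≤ n := by
      have : Nat.log 2 n < n := Nat.log_lt_self 2 (by omega)
      exact_mod_cast this
    have hJL : (J : ℝ) ≤ L + 1 := by rw [hJ]; push_cast; linarith
    have hterm : ∀ j, (numCoords n (j + 1) : ℝ) * (6 * 2 ^ (j + 1) * H + 1) ≤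
        (24 * n * H + 1) + 4 * n * (1 / 2 ^ (j + 1)) + 6 * H * 2 ^ (j + 1) := by
      intro j
      have h1 : (numCoords n (j + 1) : ℝ) ≤ 4 * n / 2 ^ (j + 1) + 1 :=
        (Nat.ceil_lt_add_one (by positivity)).le
      refine (mul_le_mul_of_nonneg_right h1 (by positivity)).trans (le_of_eq ?_)
      field_simp
      ring
    refine (Finset.sum_le_sum fun j _ => hterm j).trans ?_
    rw [Finset.sum_add_distrib, Finset.sum_add_distrib, ← Finset.mul_sum, ← Finset.mul_sum]
    simp only [Finset.sum_const, Finset.card_range, nsmul_eq_mul]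
    have s1 := mul_le_mul_of_nonneg_left (sum_inv_two_pow_le J) (by positivity : 0 ≤ 4 * (n : ℝ))
    have s2 := mul_le_mul_of_nonneg_left (sum_two_pow_le J) (by positivity : 0 ≤ 6 * H)
    have s3 : 6 * H * 2 ^ (J + 1) ≤ 24 * n * H := by
      have := two_pow_natLog_succ_le hn
      rw [← hJ] at this
      rw [pow_succ]
      nlinarith
    have s4 : (J : ℝ) * (24 * n * H + 1) ≤ 24 * n * H * (L + 1) + n := by
      have : 24 * (n : ℝ) * H * J ≤ 24 * n * H * (L + 1) :=
        mul_le_mul_of_nonneg_left hJL (by positivity)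
      linarith
    -- Of 24H(L + 2), the part 24H(L + 1) comes from the main terms of the levels and 24H from
    -- rounding up the numbers of coordinates.
    have s5 : 24 * H * (L + 2) + 5 ≤ 27.36 * (L + 1) ^ 2 := by
      nlinarith
    have s6 := mul_le_mul_of_nonneg_left s5 (by positivity : 0 ≤ (n : ℝ))
    nlinarith

lemma sum_runs_mul_deltaPrime_le {n : ℕ} (hn : 1 ≤ n) {ε : ℝ} (h0 : 0 < ε) (h1 : ε ≤ 1) :
    ((∑ j ∈ Finset.range (Nat.log 2 n + 1), numReps n ε (j + 1) * numCoords n (j + 1) : ℕ) : ℝ) *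
      deltaPrime n ε (1 / 3) ≤ 0.38 := by
  have hn' : (1 : ℝ) ≤ n := by exact_mod_cast hn
  have hH1 := one_le_harmonic hn
  have hL0 := logb_two_nonneg hn
  have hR : ∀ j, (numReps n ε (j + 1) : ℝ) * ε ≤ 6 * 2 ^ (j + 1) * (harmonic n : ℝ) + 1 := by
    intro j
    have h2 : (numReps n ε (j + 1) : ℝ) ≤ 3 / epsPrime n ε (j + 1) + 1 :=
      (Nat.ceil_lt_add_one (div_nonneg (by norm_num) (epsPrime_pos hn h0 _).le)).le
    have h3 : 3 / epsPrime n ε (j + 1) * ε = 6 * 2 ^ (j + 1) * (harmonic n : ℝ) := by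
      rw [epsPrime]; field_simp; ring
    nlinarith
  have hsum : ((∑ j ∈ Finset.range (Nat.log 2 n + 1), numReps n ε (j + 1) * numCoords n (j + 1) : ℕ)
      : ℝ) * ε ≤ 27.36 * n * (Real.logb 2 n + 1) ^ 2 := by
    push_cast
    rw [Finset.sum_mul]
    refine (Finset.sum_le_sum fun j _ => ?_).trans (sum_numCoords_mul_le hn)
    have := mul_le_mul_of_nonneg_left (hR j) (Nat.cast_nonneg (numCoords n (j + 1)))
    linarith
  rw [deltaPrime, mul_div_assoc', div_le_iff₀ (by positivity)]
  linarith

/-! ### Completeness and soundness of the joint tester -/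

section Joint

variable {n : ℕ} {σ : Type} [Fintype σ]

lemma acc_jointIdentityTester_self [NeZero n] {C : ℝ} {k : ℕ} {T : IDTesterFamily σ}
    (hT : IsBasicIDTester C k T) {ε : ℝ} (h0 : 0 < ε) (h1 : ε ≤ 1) (μ : PMF (Fin n → σ)) :
    2 / 3 ≤ Prog.acc (subCondOracle μ) (jointIdentityTester T μ ε) := by
  have hn : 1 ≤ n := Nat.one_le_iff_ne_zero.2 (NeZero.ne n)
  have hn' : (0 : ℝ) < n := by exact_mod_cast hn
  have hd0 := deltaPrime_pos hn h0
  have hd1 := deltaPrime_le hn h1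
  refine (two_thirds_le_one_sub_pow hd0.le hd1 (sum_runs_mul_deltaPrime_le hn h0 h1)).trans ?_
  rw [acc_jointIdentityTester, ← Finset.prod_pow_eq_pow_sum]
  have hb : 0 ≤ 1 - deltaPrime n ε (1 / 3) := by linarith
  refine Finset.prod_le_prod (fun j _ => pow_nonneg hb _) fun j _ => ?_
  rw [pow_mul]
  refine pow_le_pow_left₀ (pow_nonneg hb _) ?_ _
  rw [le_div_iff₀ hn']
  have : ∀ i ∈ (Finset.univ : Finset (Fin n)), (1 - deltaPrime n ε (1 / 3)) ^ numReps n ε (j + 1) ≤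
      runAcc T μ μ (epsPrime n ε (j + 1)) (deltaPrime n ε (1 / 3)) i ^ numReps n ε (j + 1) := by
    intro i _
    refine pow_le_pow_left₀ hb ?_ _
    calc 1 - deltaPrime n ε (1 / 3) =
        ∑ w, (μ w).toReal * (1 - deltaPrime n ε (1 / 3)) := by
          rw [← Finset.sum_mul, PMF.sum_toReal, one_mul]
      _ ≤ _ := Finset.sum_le_sum fun w _ => mul_le_mul_of_nonneg_left
          ((hT _ _ _ (epsPrime_pos hn h0 _) (epsPrime_lt_one hn h1 _) hd0
            (by linarith)).completeness _ rfl) ENNReal.toReal_nonneg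
  have := Finset.sum_le_sum this
  simpa [mul_comm] using this

lemma runAcc_nonneg (T : IDTesterFamily σ) (μ ν : PMF (Fin n → σ)) (ε' δ' : ℝ) (i : Fin n) :
    0 ≤ runAcc T μ ν ε' δ' i :=
  Finset.sum_nonneg fun _ _ => mul_nonneg ENNReal.toReal_nonneg (Prog.acc_nonneg _ _)

lemma runAcc_le_one (T : IDTesterFamily σ) (μ ν : PMF (Fin n → σ)) (ε' δ' : ℝ) (i : Fin n) :
    runAcc T μ ν ε' δ' i ≤ 1 := by
  rw [← PMF.sum_toReal μ]
  exact Finset.sum_le_sum fun _ _ => mul_le_of_le_one_right ENNReal.toReal_nonneg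
    (Prog.acc_le_one _ _)

/-- For a prefix at distance d the acceptance probability is at most 1 - (1 - δ')(d - ε'): by
soundness if d ≥ ε', since d - ε' ≤ 1, and trivially otherwise. This bound is affine in d, so only
the mean of d matters. -/
lemma runAcc_le {C : ℝ} {k : ℕ} {T : IDTesterFamily σ} (hT : IsBasicIDTester C k T)
    {ε' δ' : ℝ} (h0 : 0 < ε') (h1 : ε' < 1) (hd0 : 0 < δ') (hd1 : δ' < 1)
    (μ ν : PMF (Fin n → σ)) (i : Fin n)
    (h : 2 * ε' ≤ ∑ w, (μ w).toReal * tvDist (condMarginal μ i w) (condMarginal ν i w)) :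
    runAcc T μ ν ε' δ' i ≤ 1 - (1 - δ') * ε' := by
  have hw : ∀ w, Prog.acc (condOracle (condMarginal ν i w)) (T (condMarginal μ i w) ε' δ') ≤
      1 - (1 - δ') * (tvDist (condMarginal μ i w) (condMarginal ν i w) - ε') := by
    intro w
    have hd := tvDist_le_one (condMarginal μ i w) (condMarginal ν i w)
    rcases le_total ε' (tvDist (condMarginal μ i w) (condMarginal ν i w)) with hc | hc
    · have := (hT (condMarginal μ i w) ε' δ' h0 h1 hd0 hd1).soundness (condMarginal ν i w)
        (fun m hm => by rw [hm, tvDist_comm]; exact hc)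
      rw [Prog.run_false_eq] at this
      nlinarith
    · have := Prog.acc_le_one (condOracle (condMarginal ν i w)) (T (condMarginal μ i w) ε' δ')
      nlinarith
  calc runAcc T μ ν ε' δ' i ≤ ∑ w, (μ w).toReal *
        (1 - (1 - δ') * (tvDist (condMarginal μ i w) (condMarginal ν i w) - ε')) :=
        Finset.sum_le_sum fun w _ => mul_le_mul_of_nonneg_left (hw w) ENNReal.toReal_nonneg
    _ = (∑ w, (μ w).toReal) * (1 + (1 - δ') * ε') - (1 - δ') *
        ∑ w, (μ w).toReal * tvDist (condMarginal μ i w) (condMarginal ν i w) := by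
        rw [Finset.sum_mul, Finset.mul_sum, ← Finset.sum_sub_distrib]
        exact Finset.sum_congr rfl fun w _ => by ring
    _ ≤ _ := by rw [PMF.sum_toReal]; nlinarith

lemma acc_jointIdentityTester_far [NeZero n] {C : ℝ} {k : ℕ} {T : IDTesterFamily σ}
    (hT : IsBasicIDTester C k T) {ε : ℝ} (h0 : 0 < ε) (h1 : ε ≤ 1) (μ ν : PMF (Fin n → σ))
    (hd : ε ≤ tvDist μ ν) :
    Prog.acc (subCondOracle ν) (jointIdentityTester T μ ε) ≤ 1 / 3 := by
  have hn : 1 ≤ n := Nat.one_le_iff_ne_zero.2 (NeZero.ne n)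
  have hn' : (0 : ℝ) < n := by exact_mod_cast hn
  have hd0 := deltaPrime_pos hn h0
  have hd1 := deltaPrime_le hn h1
  have hH := one_le_harmonic hn
  set x : Fin n → ℝ := fun i =>
    ∑ w, (μ w).toReal * tvDist (condMarginal μ i w) (condMarginal ν i w) with hx
  obtain ⟨m, hm1, hmn, hm⟩ := exists_card_le_of_le_sum hn x
    (hd.trans (tvDist_le_sum_condMarginal μ ν))
  -- The relevant level is j + 1: from m < 2^(j+1) follows 2ε' ≤ ε / (m H(n)), and from 2^j ≤ m that
  -- the m good coordinates are hit twice on average.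
  set j := Nat.log 2 m with hj
  set G := Finset.univ.filter fun i => ε / (m * (harmonic n : ℝ)) ≤ x i with hG
  have hm1' : (1 : ℝ) ≤ m := by exact_mod_cast hm1
  have hmlt : (m : ℝ) < 2 ^ (j + 1) := by exact_mod_cast Nat.lt_pow_succ_log_self one_lt_two m
  have hmge : (2 : ℝ) ^ j ≤ m := by exact_mod_cast Nat.pow_log_le_self 2 (by omega)
  have hjmem : j ∈ Finset.range (Nat.log 2 n + 1) :=
    Finset.mem_range.2 (Nat.lt_succ_of_le (Nat.log_mono_right hmn))
  set ε' := epsPrime n ε (j + 1) with hε'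
  set δ' := deltaPrime n ε (1 / 3) with hδ'
  have he0 : 0 < ε' := epsPrime_pos hn h0 _
  have he1 : ε' < 1 := epsPrime_lt_one hn h1 _
  set R := numReps n ε (j + 1) with hR
  set K := numCoords n (j + 1) with hK
  -- At least 3/ε' repetitions give exp(-3(1 - δ')), and 3 · 71/72 > 2.9.
  have hgood : ∀ i ∈ G, runAcc T μ ν ε' δ' i ^ R ≤ 0.26 := by
    intro i hi
    have hxi : 2 * ε' ≤ x i := by
      refine le_trans ?_ (Finset.mem_filter.1 hi).2
      rw [hε', epsPrime, pow_succ, mul_div_assoc', div_le_div_iff₀ (by positivity) (by positivity)]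
      have : (m : ℝ) * (harmonic n * (2 * ε)) ≤ 2 ^ (j + 1) * (harmonic n * (2 * ε)) := by gcongr
      linarith
    have h2 := runAcc_le hT he0 he1 hd0 (by linarith) μ ν i hxi
    have h3 : 1 - (1 - δ') * ε' ≤ Real.exp (-((1 - δ') * ε')) := by
      have := Real.add_one_le_exp (-((1 - δ') * ε')); linarith
    have hRe : 3 ≤ R * ε' := by
      rw [← div_le_iff₀ he0]; exact Nat.le_ceil _
    calc runAcc T μ ν ε' δ' i ^ R ≤ Real.exp (-((1 - δ') * ε')) ^ R :=
          pow_le_pow_left₀ (runAcc_nonneg _ _ _ _ _ _) (h2.trans h3) _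
      _ ≤ Real.exp (-2.9) := by
          rw [← Real.exp_nat_mul, Real.exp_le_exp]; nlinarith
      _ ≤ 0.26 := by
          rw [Real.exp_neg, inv_le_comm₀ (Real.exp_pos _) (by norm_num)]
          have := Real.add_one_le_exp (2.9 : ℝ)
          norm_num at this ⊢; linarith
  have havg : ∀ j', (∑ i, runAcc T μ ν (epsPrime n ε j') δ' i ^ numReps n ε j') / n ≤ 1 := by
    intro j'
    rw [div_le_one hn']
    calc _ ≤ ∑ _i : Fin n, (1 : ℝ) := Finset.sum_le_sum fun i _ =>
          pow_le_one₀ (runAcc_nonneg _ _ _ _ _ _) (runAcc_le_one _ _ _ _ _ _)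
      _ = n := by simp
  have havg0 : ∀ j', 0 ≤ (∑ i, runAcc T μ ν (epsPrime n ε j') δ' i ^ numReps n ε j') / n :=
    fun j' => div_nonneg (Finset.sum_nonneg fun i _ => pow_nonneg (runAcc_nonneg _ _ _ _ _ _) _)
      hn'.le
  have hjavg : (∑ i, runAcc T μ ν ε' δ' i ^ R) / n ≤ 1 - 0.74 * m / n := by
    rw [div_le_iff₀ hn', sub_mul, div_mul_cancel₀ _ hn'.ne', one_mul]
    have hle : ∀ i ∈ (Finset.univ : Finset (Fin n)), runAcc T μ ν ε' δ' i ^ R ≤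
        1 - if ε / (m * (harmonic n : ℝ)) ≤ x i then 0.74 else 0 := by
      intro i _
      split_ifs with h
      · have := hgood i (Finset.mem_filter.2 ⟨Finset.mem_univ _, h⟩); norm_num at this ⊢; linarith
      · rw [sub_zero]
        exact pow_le_one₀ (runAcc_nonneg _ _ _ _ _ _) (runAcc_le_one _ _ _ _ _ _)
    refine (Finset.sum_le_sum hle).trans ?_
    rw [Finset.sum_sub_distrib, ← Finset.sum_filter]
    simp only [Finset.sum_const, nsmul_eq_mul, Finset.card_univ, Fintype.card_fin, mul_one]
    have : (m : ℝ) ≤ G.card := by exact_mod_cast hm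
    linarith
  rw [acc_jointIdentityTester, ← Finset.mul_prod_erase _ _ hjmem]
  refine (mul_le_of_le_one_right (pow_nonneg (havg0 _) _) (Finset.prod_le_one
    (fun i _ => pow_nonneg (havg0 _) _) fun i _ => pow_le_one₀ (havg0 _) (havg _))).trans ?_
  have hKm : 2 ≤ K * (m / n : ℝ) := by
    have : (4 * n / 2 ^ (j + 1) : ℝ) ≤ K := Nat.le_ceil _
    calc (2 : ℝ) = 4 * n / 2 ^ (j + 1) * (2 ^ j / n) := by field_simp; ring
      _ ≤ _ := by gcongr
  -- The exponent is at least 2 · 0.74 = 1.48, and e^1.48 ≥ 1.48 e > 3.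
  calc _ ≤ Real.exp (-(0.74 * m / n)) ^ K := by
        refine pow_le_pow_left₀ (havg0 _) (hjavg.trans ?_) _
        have := Real.add_one_le_exp (-(0.74 * m / n : ℝ)); linarith
    _ ≤ Real.exp (-(1 + 0.48)) := by
        rw [← Real.exp_nat_mul, Real.exp_le_exp, mul_div_assoc]; nlinarith
    _ ≤ 1 / 3 := by
        rw [Real.exp_neg, inv_le_comm₀ (Real.exp_pos _) (by norm_num), Real.exp_add]
        have e1 := Real.exp_one_gt_d9
        have e2 := Real.add_one_le_exp (0.48 : ℝ)
        norm_num at e1 e2 ⊢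
        nlinarith

end Joint

/-! ### Sample complexity of the joint tester -/

section JointComplexity

variable {n : ℕ} {ε : ℝ}

lemma one_le_one_add_log_add_log (hn : 1 ≤ n) (h0 : 0 < ε) (h1 : ε ≤ 1) :
    1 ≤ 1 + Real.log n + Real.log (1 / ε) := by
  have := Real.log_nonneg (show (1 : ℝ) ≤ n by exact_mod_cast hn)
  have := Real.log_nonneg (one_le_one_div h0 h1)
  linarith

lemma logb_two_le (hn : 1 ≤ n) : Real.logb 2 n ≤ 2 * Real.log n := by
  have := Real.log_nonneg (show (1 : ℝ) ≤ n by exact_mod_cast hn)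
  have := Real.log_two_gt_d9
  rw [Real.logb, div_le_iff₀ (by linarith)]
  nlinarith

lemma one_add_log_inv_deltaPrime_le (hn : 1 ≤ n) (h0 : 0 < ε) (h1 : ε ≤ 1) :
    1 + Real.log (1 / deltaPrime n ε (1 / 3)) ≤ 72 * (1 + Real.log n + Real.log (1 / ε)) := by
  have hn' : (1 : ℝ) ≤ n := by exact_mod_cast hn
  have hL := logb_two_nonneg hn
  have e : 1 / deltaPrime n ε (1 / 3) = 72 * n * (Real.logb 2 n + 1) ^ 2 * (1 / ε) := by
    rw [deltaPrime]; field_simp; norm_num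
  rw [e, Real.log_mul (by positivity) (by positivity), Real.log_mul (by positivity) (by positivity),
    Real.log_mul (by positivity) (by positivity), Real.log_pow]
  have a1 := Real.log_le_sub_one_of_pos (show (0 : ℝ) < 72 by norm_num)
  have a2 := Real.log_le_sub_one_of_pos (show (0 : ℝ) < Real.logb 2 n + 1 by linarith)
  have a3 := logb_two_le hn
  have a4 := Real.log_nonneg hn'
  have a5 := Real.log_nonneg (one_le_one_div h0 h1)
  push_cast
  linarith

lemma one_div_epsPrime_le (hn : 1 ≤ n) (h0 : 0 < ε) (h1 : ε ≤ 1) {j : ℕ}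
    (hj : (2 : ℝ) ^ j ≤ 2 * n) :
    1 / epsPrime n ε j ≤ 4 * n * (1 + Real.log n + Real.log (1 / ε)) / ε := by
  have hH := one_le_harmonic hn
  have a1 := harmonic_le_log n
  have a2 := Real.log_nonneg (one_le_one_div h0 h1)
  have e : 4 * n * (1 + Real.log n + Real.log (1 / ε)) =
      2 * n * 2 * (1 + Real.log n + Real.log (1 / ε)) := by ring
  rw [epsPrime, one_div_div, pow_succ, e]
  gcongr
  linarith

/-- An explicit bound for the number of queries in a single run. -/
lemma single_run_queries_le (C : ℝ) (k : ℕ) (hn : 1 ≤ n) (h0 : 0 < ε) (h1 : ε ≤ 1) {j : ℕ}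
    (hj : (2 : ℝ) ^ j ≤ 2 * n) :
    (⌊C * ((1 + Real.log (1 / deltaPrime n ε (1 / 3))) / epsPrime n ε j ^ 2) *
        (1 + Real.log ((1 + Real.log (1 / deltaPrime n ε (1 / 3))) / epsPrime n ε j ^ 2)) ^ k⌋₊ : ℝ)
      ≤ |C| * (1152 * n ^ 2 * (1 + Real.log n + Real.log (1 / ε)) ^ 3 / ε ^ 2) *
        (1152 * (1 + Real.log n + Real.log (1 / ε))) ^ k := by
  have hn' : (1 : ℝ) ≤ n := by exact_mod_cast hn
  have hd0 := deltaPrime_pos hn h0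
  have hd1 := deltaPrime_le hn h1
  have he0 := epsPrime_pos hn h0 j
  have he1 := epsPrime_lt_one hn h1 j
  have hΛ := one_le_one_add_log_add_log hn h0 h1
  have hδ := one_add_log_inv_deltaPrime_le hn h0 h1
  have hε := one_div_epsPrime_le hn h0 h1 hj
  have a4 := Real.log_nonneg hn'
  have a5 := Real.log_nonneg (one_le_one_div h0 h1)
  set Λ := 1 + Real.log n + Real.log (1 / ε) with hΛd
  set f := (1 + Real.log (1 / deltaPrime n ε (1 / 3))) / epsPrime n ε j ^ 2 with hf
  have hlδ : 0 ≤ Real.log (1 / deltaPrime n ε (1 / 3)) :=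
    Real.log_nonneg (one_le_one_div hd0 (by linarith))
  have hf1 : 1 ≤ f := by
    rw [hf, one_le_div (by positivity)]
    have : epsPrime n ε j ^ 2 ≤ 1 := pow_le_one₀ he0.le he1.le
    linarith
  -- 1152 = 72 · 4², from the bounds on log(1/δ') and 1/ε'.
  have hfle : f ≤ 1152 * n ^ 2 * Λ ^ 3 / ε ^ 2 := by
    have : f = (1 + Real.log (1 / deltaPrime n ε (1 / 3))) * (1 / epsPrime n ε j) ^ 2 := by
      rw [hf]; field_simp
    rw [this]
    calc _ ≤ 72 * Λ * (4 * n * Λ / ε) ^ 2 := by gcongr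
      _ = _ := by field_simp; ring
  have hlog : 1 + Real.log f ≤ 1152 * Λ := by
    have b1 := Real.log_le_log (by linarith) hfle
    have e : 1152 * (n : ℝ) ^ 2 * Λ ^ 3 / ε ^ 2 = 1152 * (n : ℝ) ^ 2 * Λ ^ 3 * (1 / ε) ^ 2 := by
      field_simp
    rw [e, Real.log_mul (by positivity) (by positivity), Real.log_mul (by positivity)
      (by positivity), Real.log_mul (by positivity) (by positivity), Real.log_pow, Real.log_pow,
      Real.log_pow] at b1
    have b2 := Real.log_le_sub_one_of_pos (show (0 : ℝ) < 1152 by norm_num)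
    have b3 := Real.log_le_sub_one_of_pos (show (0 : ℝ) < Λ by linarith)
    push_cast at b1
    linarith
  have hlog0 := Real.log_nonneg hf1
  -- The sign of `C` is not prescribed; |C| makes the later estimates monotone.
  have hle : C * f * (1 + Real.log f) ^ k ≤ |C| * f * (1 + Real.log f) ^ k := by
    gcongr; exact le_abs_self C
  calc _ ≤ ((⌊|C| * f * (1 + Real.log f) ^ k⌋₊ : ℕ) : ℝ) := by exact_mod_cast Nat.floor_mono hle
    _ ≤ |C| * f * (1 + Real.log f) ^ k := Nat.floor_le (by positivity)
    _ ≤ _ := by gcongr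

/-- Both rounded quantities are at least 1, so each ceiling at most doubles its argument. The
factors 2^j cancel, so all levels make comparably many runs. -/
lemma numCoords_mul_numReps_le (hn : 1 ≤ n) (h0 : 0 < ε) (h1 : ε ≤ 1) {j : ℕ}
    (hj : (2 : ℝ) ^ j ≤ 2 * n) :
    (numCoords n j * numReps n ε j : ℝ) ≤
      96 * n * (1 + Real.log n + Real.log (1 / ε)) / ε := by
  have hH := one_le_harmonic hn
  have a1 := harmonic_le_log n
  have a2 := Real.log_nonneg (one_le_one_div h0 h1)
  have hK : (numCoords n j : ℝ) ≤ 8 * n / 2 ^ j := by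
    have h2 : 1 ≤ (4 * n / 2 ^ j : ℝ) := by
      rw [one_le_div (by positivity)]; linarith
    have h3 : (numCoords n j : ℝ) ≤ 4 * n / 2 ^ j + 1 := (Nat.ceil_lt_add_one (by positivity)).le
    have h4 : (8 * n / 2 ^ j : ℝ) = 4 * n / 2 ^ j + 4 * n / 2 ^ j := by ring
    linarith
  have hR : (numReps n ε j : ℝ) ≤ 12 * 2 ^ j * (harmonic n : ℝ) / ε := by
    have he0 := epsPrime_pos hn h0 j
    have he1 := epsPrime_lt_one hn h1 j
    have h3 : (numReps n ε j : ℝ) ≤ 3 / epsPrime n ε j + 1 := (Nat.ceil_lt_add_one (by positivity)).le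
    have h4 : 1 ≤ 3 / epsPrime n ε j := by rw [one_le_div he0]; linarith
    have h5 : 3 / epsPrime n ε j + 3 / epsPrime n ε j = 12 * 2 ^ j * (harmonic n : ℝ) / ε := by
      rw [epsPrime]; field_simp; ring
    linarith
  calc _ ≤ (8 * n / 2 ^ j) * (12 * 2 ^ j * (harmonic n : ℝ) / ε) := by gcongr
    _ = 96 * n * (harmonic n : ℝ) / ε := by field_simp; ring
    _ ≤ _ := by gcongr; linarith

end JointComplexity

/-- The joint tester built from a basic tester is a subcube-conditional identity tester. -/
lemma isSubCondIdentityTester_jointIdentityTester (C : ℝ) (k : ℕ) :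
    ∃ (C' : ℝ) (k' : ℕ), ∀ (σ : Type) [Fintype σ] (T : IDTesterFamily σ), IsBasicIDTester C k T →
      ∀ (n : ℕ) [NeZero n] (ε : ℝ), 0 < ε → ε ≤ 1 → ∀ μ : PMF (Fin n → σ),
        IsSubCondIdentityTester μ ε (1 / 3)
          ⌊C' * ((n : ℝ) ^ 3 / ε ^ 3) * (1 + Real.log n + Real.log (1 / ε)) ^ k'⌋₊
          (jointIdentityTester T μ ε) := by
  -- At most 2Λ levels, each with at most 96nΛ/ε runs of at most |C| (1152n²Λ³/ε²)(1152Λ)^k queries;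
  -- Λ occurs to the power 1 + 1 + 3 + k.
  refine ⟨2 * 96 * 1152 * 1152 ^ k * |C|, k + 5, fun σ _ T hT n _ ε h0 h1 μ => ⟨?_, ?_, ?_⟩⟩
  · have hn : 1 ≤ n := Nat.one_le_iff_ne_zero.2 (NeZero.ne n)
    have hn' : (1 : ℝ) ≤ n := by exact_mod_cast hn
    have hΛ := one_le_one_add_log_add_log hn h0 h1
    have hd0 := deltaPrime_pos hn h0
    have hd1 := deltaPrime_le hn h1
    refine (queriesAtMost_jointIdentityTester T μ ε _ fun j m _ =>
      (hT m _ _ (epsPrime_pos hn h0 j) (epsPrime_lt_one hn h1 j) hd0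
        (by linarith)).complexity).mono (Nat.le_floor ?_)
    have hJ : ((Nat.log 2 n + 1 : ℕ) : ℝ) ≤ 2 * (1 + Real.log n + Real.log (1 / ε)) := by
      have b1 := natLog_le_logb n
      have b2 := logb_two_le hn
      have b3 := Real.log_nonneg (one_le_one_div h0 h1)
      push_cast
      linarith
    set Λ := 1 + Real.log n + Real.log (1 / ε) with hΛd
    push_cast
    refine (Finset.sum_le_card_nsmul _ _ (96 * n * Λ / ε *
        (|C| * (1152 * n ^ 2 * Λ ^ 3 / ε ^ 2) * (1152 * Λ) ^ k)) fun j hj => ?_).trans ?_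
    · have hj2 : (2 : ℝ) ^ (j + 1) ≤ 2 * n := by
        refine le_trans (pow_le_pow_right₀ one_le_two ?_) (two_pow_natLog_succ_le hn)
        have := Finset.mem_range.1 hj; omega
      have c1 := numCoords_mul_numReps_le hn h0 h1 hj2
      have c2 := single_run_queries_le C k hn h0 h1 hj2
      refine le_trans (le_of_eq (mul_assoc _ _ _).symm) (mul_le_mul c1 c2 (Nat.cast_nonneg _) ?_)
      positivity
    rw [Finset.card_range, nsmul_eq_mul]
    refine (mul_le_mul_of_nonneg_right hJ (by positivity)).trans (le_of_eq ?_)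
    rw [mul_pow, pow_add]
    field_simp
  · intro ν hν
    rw [hν]
    have := acc_jointIdentityTester_self hT h0 h1 μ
    change 1 - 1 / 3 ≤ Prog.acc _ _
    linarith
  · intro ν hν
    rw [Prog.run_false_eq]
    have := acc_jointIdentityTester_far hT h0 h1 μ ν (by rw [tvDist_comm]; exact hν μ rfl)
    linarith

/-! ### Deviations and relative weights along a ranking -/

section Ranked

variable {σ : Type}

/-- The total weight of the elements of `s` whose rank is less than that of `y`. -/
def below (r : σ → ℕ) (s : Finset σ) (f : σ → ℝ) (y : σ) : ℝ := ∑ x ∈ s with r x < r y, f x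

lemma below_nonneg (r : σ → ℕ) (s : Finset σ) {f : σ → ℝ} (hf : ∀ x, 0 ≤ f x) (y : σ) :
    0 ≤ below r s f y := Finset.sum_nonneg fun x _ => hf x

/-- The deviation of `p` from `q` at `y`, relative to the elements of `s` of rank at most that of
`y`; elements `y` in the initial segments of `q`-weight less than `γ` are ignored. -/
noncomputable def deviation (r : σ → ℕ) (γ : ℝ) (p q : σ → ℝ) (s : Finset σ) (y : σ) : ℝ :=
  if γ ≤ below r s q y + q y then
    |p y * below r s q y - q y * below r s p y| / (below r s q y + q y) else 0

/-- The weight of `y` relative to the elements of `s` of rank at most that of `y`, with the same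
truncation. -/
noncomputable def relWeight (r : σ → ℕ) (γ : ℝ) (q : σ → ℝ) (s : Finset σ) (y : σ) : ℝ :=
  if γ ≤ below r s q y + q y then q y / (below r s q y + q y) else 0

lemma deviation_nonneg (r : σ → ℕ) {γ : ℝ} (hγ : 0 < γ) (p q : σ → ℝ) (s : Finset σ) (y : σ) :
    0 ≤ deviation r γ p q s y := by
  unfold deviation
  split_ifs with h
  · exact div_nonneg (abs_nonneg _) (hγ.le.trans h)
  · exact le_rfl

lemma relWeight_nonneg (r : σ → ℕ) {γ : ℝ} (hγ : 0 < γ) {q : σ → ℝ} (hq : ∀ x, 0 ≤ q x)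
    (s : Finset σ) (y : σ) : 0 ≤ relWeight r γ q s y := by
  unfold relWeight
  split_ifs with h
  · exact div_nonneg (hq y) (hγ.le.trans h)
  · exact le_rfl

variable [DecidableEq σ] {r : σ → ℕ} {s : Finset σ} {a : σ}

lemma below_insert_of_mem (hmax : ∀ x ∈ s, r x ≤ r a) (f : σ → ℝ) {y : σ}
    (hy : y ∈ s) : below r (insert a s) f y = below r s f y := by
  rw [below, below, Finset.filter_insert, if_neg (not_lt.2 (hmax y hy))]

lemma below_insert_self (hr : Function.Injective r) (hmax : ∀ x ∈ s, r x ≤ r a) (ha : a ∉ s)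
    (f : σ → ℝ) : below r (insert a s) f a = ∑ x ∈ s, f x := by
  rw [below, Finset.filter_insert, if_neg (lt_irrefl _), Finset.filter_true_of_mem]
  exact fun x hx => lt_of_le_of_ne (hmax x hx) fun h => ha (hr h ▸ hx)

lemma below_add_self_le {f : σ → ℝ} (hf : ∀ x, 0 ≤ f x) {y : σ} (hy : y ∈ s) :
    below r s f y + f y ≤ ∑ x ∈ s, f x := by
  have h : y ∉ s.filter fun x => r x < r y := by simp
  rw [below, add_comm, ← Finset.sum_insert h]
  refine Finset.sum_le_sum_of_subset_of_nonneg (fun x hx => ?_) fun x _ _ => hf x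
  rcases Finset.mem_insert.1 hx with rfl | hx
  · exact hy
  · exact (Finset.mem_filter.1 hx).1

/-- Adding the top element a changes the ratio h = P/Q to h'. Its deviation e equals |p a - q a ·
h'| and Q|h - h'|. So the new term, the change of ratio in the old terms, and the change of 2γh cost
e, e and 2e. -/
lemma sum_abs_sub_le_sum_deviation (hr : Function.Injective r) {γ : ℝ} (hγ : 0 < γ) {p q : σ → ℝ}
    (hp : ∀ x, 0 ≤ p x) (hq : ∀ x, 0 ≤ q x) (s : Finset σ) (hs : γ ≤ ∑ x ∈ s, q x) :
    ∑ y ∈ s, |p y - q y * ((∑ x ∈ s, p x) / ∑ x ∈ s, q x)| ≤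
      4 * ∑ y ∈ s, deviation r γ p q s y + 2 * γ * ((∑ x ∈ s, p x) / ∑ x ∈ s, q x) := by
  induction s using Finset.induction_on_max_value r with
  | empty => simp at hs; linarith
  | insert a s ha hmax ih =>
    have hdev : ∀ y ∈ s, deviation r γ p q (insert a s) y = deviation r γ p q s y := fun y hy => by
      simp only [deviation, below_insert_of_mem hmax _ hy]
    have hdeva : deviation r γ p q (insert a s) a =
        |p a * ∑ x ∈ s, q x - q a * ∑ x ∈ s, p x| / (∑ x ∈ s, q x + q a) := by
      rw [Finset.sum_insert ha, add_comm] at hs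
      rw [deviation, below_insert_self hr hmax ha, below_insert_self hr hmax ha, if_pos hs]
    rw [Finset.sum_insert ha] at hs
    rw [Finset.sum_insert ha, Finset.sum_insert ha, Finset.sum_insert ha, Finset.sum_insert ha,
      hdeva, Finset.sum_congr rfl hdev]
    have hdev0 : 0 ≤ ∑ y ∈ s, deviation r γ p q s y :=
      Finset.sum_nonneg fun y _ => deviation_nonneg r hγ p q s y
    have hP0 : 0 ≤ ∑ x ∈ s, p x := Finset.sum_nonneg fun x _ => hp x
    have hQ0 : 0 ≤ ∑ x ∈ s, q x := Finset.sum_nonneg fun x _ => hq x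
    have hpa := hp a
    have hqa := hq a
    set P := ∑ x ∈ s, p x with hPd
    set Q := ∑ x ∈ s, q x with hQd
    set h' := (p a + P) / (q a + Q) with hh'
    set e := |p a * Q - q a * P| / (Q + q a) with he
    have hden : 0 < q a + Q := by linarith
    have hh0 : 0 ≤ h' := by positivity
    have e1 : |p a - q a * h'| = e := by
      rw [he, ← abs_of_pos (show 0 < Q + q a by linarith), ← abs_div, hh']
      congr 1; rw [add_comm Q]; field_simp; ring
    have e2 : |P - Q * h'| = e := by
      rw [he, ← abs_of_pos (show 0 < Q + q a by linarith), ← abs_div, ← abs_neg, hh']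
      congr 1; rw [add_comm Q]; field_simp; ring
    rw [e1]
    -- If the old segment is below the truncation, the induction hypothesis is unavailable; there
    -- the crude bound P + Q h' ≤ 2γh' + e suffices.
    rcases lt_or_ge Q γ with hQ | hQ
    · have : ∑ y ∈ s, |p y - q y * h'| ≤ P + Q * h' := by
        rw [hPd, hQd, Finset.sum_mul, ← Finset.sum_add_distrib]
        refine Finset.sum_le_sum fun y _ => (abs_sub _ _).trans (le_of_eq ?_)
        rw [abs_of_nonneg (hp y), abs_of_nonneg (mul_nonneg (hq y) hh0)]
      have := (le_abs_self _).trans e2.le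
      have : Q * h' ≤ γ * h' := by gcongr
      have : 0 ≤ e := e2 ▸ abs_nonneg _
      linarith
    · have ih := ih hQ
      set h := P / Q with hh
      have hQpos : 0 < Q := by linarith
      have e3 : Q * |h - h'| = e := by
        rw [← e2, ← abs_of_pos hQpos, ← abs_mul, abs_of_pos hQpos, mul_sub, hh,
          mul_div_cancel₀ _ hQpos.ne']
      have h1 : ∑ y ∈ s, |p y - q y * h'| ≤ ∑ y ∈ s, |p y - q y * h| + Q * |h - h'| := by
        rw [hQd, Finset.sum_mul, ← Finset.sum_add_distrib]
        refine Finset.sum_le_sum fun y _ => ?_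
        calc |p y - q y * h'| = |(p y - q y * h) + q y * (h - h')| := by ring_nf
          _ ≤ |p y - q y * h| + |q y * (h - h')| := abs_add_le _ _
          _ = _ := by rw [abs_mul, abs_of_nonneg (hq y)]
      have h2 : γ * h ≤ γ * h' + e := by
        have : γ * (h - h') ≤ Q * |h - h'| :=
          (mul_le_mul_of_nonneg_left (le_abs_self _) hγ.le).trans
            (mul_le_mul_of_nonneg_right hQ (abs_nonneg _))
        linarith
      linarith

/-- Each term is at most the increment of the logarithm of the segment mass, so the sum telescopes;
the element that crosses γ contributes at most 1. Without truncation the bound would depend on the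
smallest masses. -/
lemma sum_relWeight_le (hr : Function.Injective r) {γ : ℝ} (hγ : 0 < γ) {q : σ → ℝ}
    (hq : ∀ x, 0 ≤ q x) (s : Finset σ) (hs : γ ≤ ∑ x ∈ s, q x) :
    ∑ y ∈ s, relWeight r γ q s y ≤ 1 + Real.log ((∑ x ∈ s, q x) / γ) := by
  induction s using Finset.induction_on_max_value r with
  | empty => simp at hs; linarith
  | insert a s ha hmax ih =>
    have hw : ∀ y ∈ s, relWeight r γ q (insert a s) y = relWeight r γ q s y := fun y hy => by
      simp only [relWeight, below_insert_of_mem hmax _ hy]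
    have hwa : relWeight r γ q (insert a s) a = q a / (∑ x ∈ s, q x + q a) := by
      rw [Finset.sum_insert ha, add_comm] at hs
      rw [relWeight, below_insert_self hr hmax ha, if_pos hs]
    rw [Finset.sum_insert ha] at hs
    rw [Finset.sum_insert ha, Finset.sum_insert ha, hwa, Finset.sum_congr rfl hw]
    have hQ0 : 0 ≤ ∑ x ∈ s, q x := Finset.sum_nonneg fun x _ => hq x
    have hqa := hq a
    rcases lt_or_ge (∑ x ∈ s, q x) γ with hQ | hQ
    · have hz : ∑ y ∈ s, relWeight r γ q s y = 0 := Finset.sum_eq_zero fun y hy => by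
        rw [relWeight, if_neg]
        have := below_add_self_le (r := r) hq hy
        linarith
      rw [hz]
      have h1 : q a / (∑ x ∈ s, q x + q a) ≤ 1 := by rw [div_le_one (by linarith)]; linarith
      have h2 : 0 ≤ Real.log ((q a + ∑ x ∈ s, q x) / γ) :=
        Real.log_nonneg ((one_le_div hγ).2 hs)
      linarith
    · have ih := ih hQ
      set Q := ∑ x ∈ s, q x
      have hQpos : 0 < Q := by linarith
      have h1 : q a / (Q + q a) ≤ Real.log ((q a + Q) / Q) := by
        have := Real.one_sub_inv_le_log_of_pos (show 0 < (q a + Q) / Q by positivity)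
        refine le_trans (le_of_eq ?_) this
        field_simp; ring
      rw [Real.log_div (by linarith) (by linarith)] at h1 ih ⊢
      linarith

end Ranked

/-! ### Blocks of comparable mass and the random pair -/

section Blocks

variable {σ : Type} [Fintype σ] (r : σ → ℕ) (q : σ → ℝ)

/-- The position of `x` when the elements below `y` are cut into blocks of weight about `q y`. -/
noncomputable def blockIndex (y x : σ) : ℕ := ⌊below r Finset.univ q x / q y⌋₊

/-- The `m`-th block of elements below `y`. -/
noncomputable def block (y : σ) (m : ℕ) : Finset σ :=
  Finset.univ.filter fun x => r x < r y ∧ blockIndex r q y x = m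

/-- The number of blocks of elements below `y`. -/
noncomputable def numBlocks (y : σ) : ℕ := blockIndex r q y y + 1

variable {r q}

/-- The starting points of the elements of a block lie in an interval of length `q y`, and the last
element adds at most another `q y`. -/
lemma sum_block_le (hr : Function.Injective r) (hq : ∀ x, 0 ≤ q x)
    (hmono : ∀ x y, r x < r y → q x ≤ q y) {y : σ} (hy : 0 < q y) (m : ℕ) :
    ∑ x ∈ block r q y m, q x ≤ 2 * q y := by
  classical
  rcases (block r q y m).eq_empty_or_nonempty with h | h
  · rw [h, Finset.sum_empty]; positivity
  obtain ⟨z, hz, hzmax⟩ := Finset.exists_max_image _ r h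
  obtain ⟨u, hu, humin⟩ := Finset.exists_min_image _ r h
  obtain ⟨hz1, hz2⟩ := (Finset.mem_filter.1 hz).2
  obtain ⟨-, hu2⟩ := (Finset.mem_filter.1 hu).2
  have b1 : below r Finset.univ q z < (m + 1) * q y := by
    rw [← div_lt_iff₀ hy, ← hz2]; exact Nat.lt_floor_add_one _
  have b2 : m * q y ≤ below r Finset.univ q u := by
    rw [← le_div_iff₀ hy, ← hu2]
    exact Nat.floor_le (div_nonneg (below_nonneg r _ hq u) hy.le)
  have b3 : ∑ x ∈ block r q y m, q x + below r Finset.univ q u ≤ below r Finset.univ q z + q z := by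
    have hd : Disjoint (block r q y m) (Finset.univ.filter fun x => r x < r u) := by
      rw [Finset.disjoint_left]
      exact fun x hx hx' => absurd (Finset.mem_filter.1 hx').2 (not_lt.2 (humin x hx))
    have hz' : z ∉ Finset.univ.filter fun x => r x < r z := by simp
    rw [below, ← Finset.sum_union hd, below, add_comm, ← Finset.sum_insert hz']
    refine Finset.sum_le_sum_of_subset_of_nonneg (fun x hx => ?_) fun x _ _ => hq x
    have hxz : r x ≤ r z := by
      rcases Finset.mem_union.1 hx with hx | hx
      · exact hzmax x hx
      · exact (Finset.mem_filter.1 hx).2.le.trans (hzmax u hu)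
    rcases hxz.eq_or_lt with h | h
    · rw [hr h]; exact Finset.mem_insert_self _ _
    · exact Finset.mem_insert_of_mem (Finset.mem_filter.2 ⟨Finset.mem_univ _, h⟩)
  have b4 := hmono z y hz1
  linarith

lemma numBlocks_mul_le (hq : ∀ x, 0 ≤ q x) {y : σ} (hy : 0 < q y) :
    numBlocks r q y * q y ≤ below r Finset.univ q y + q y := by
  have h : (blockIndex r q y y : ℝ) ≤ below r Finset.univ q y / q y :=
    Nat.floor_le (div_nonneg (below_nonneg r _ hq y) hy.le)
  rw [le_div_iff₀ hy] at h
  rw [numBlocks]; push_cast; linarith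

lemma below_mono (hq : ∀ x, 0 ≤ q x) {x y : σ} (h : r x ≤ r y) :
    below r Finset.univ q x ≤ below r Finset.univ q y := by
  refine Finset.sum_le_sum_of_subset_of_nonneg (fun z hz => ?_) fun z _ _ => hq z
  simp only [Finset.mem_filter, Finset.mem_univ, true_and] at hz ⊢
  omega

lemma blockIndex_lt (hq : ∀ x, 0 ≤ q x) {x y : σ} (h : r x ≤ r y) :
    blockIndex r q y x < numBlocks r q y :=
  Nat.lt_succ_of_le (Nat.floor_mono (div_le_div_of_nonneg_right (below_mono hq h) (hq y)))

/-- The blocks partition the elements below `y`. -/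
lemma sum_below_eq_sum_blocks (hq : ∀ x, 0 ≤ q x) (y : σ) (f : σ → ℝ) :
    ∑ x with r x < r y, f x =
      ∑ m ∈ Finset.range (numBlocks r q y), ∑ x ∈ block r q y m, f x := by
  rw [← Finset.sum_fiberwise_of_maps_to (g := blockIndex r q y)
    (t := Finset.range (numBlocks r q y))]
  · refine Finset.sum_congr rfl fun m _ => Finset.sum_congr ?_ fun _ _ => rfl
    rw [block, Finset.filter_filter]
  · exact fun x hx => Finset.mem_range.2 (blockIndex_lt hq (Finset.mem_filter.1 hx).2.le)

variable (r q) in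
/-- The expectation of `φ y m` for a random element `y` and block `m`: for a sample `x` from `p`,
with probability one half each, either `y = x` and `m` is uniform, or `y` has law `κ` and `m` is
the index of the block of `x`. -/
noncomputable def pairExp (κ p : σ → ℝ) (φ : σ → ℕ → ℝ) : ℝ :=
  ∑ x, p x * (1 / 2 * ((∑ m ∈ Finset.range (numBlocks r q x), φ x m) / numBlocks r q x) +
    1 / 2 * ∑ y, κ y * φ y (blockIndex r q y x))

lemma pairExp_mono {κ p : σ → ℝ} (hκ : ∀ x, 0 ≤ κ x) (hp : ∀ x, 0 ≤ p x) {φ ψ : σ → ℕ → ℝ}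
    (h : ∀ y m, φ y m ≤ ψ y m) : pairExp r q κ p φ ≤ pairExp r q κ p ψ := by
  unfold pairExp
  gcongr with x _ m _ y _
  · exact hp x
  · exact h _ _
  · exact hκ y
  · exact h _ _

lemma pairExp_const {κ p : σ → ℝ} (hκ : ∑ x, κ x = 1) (hp : ∑ x, p x = 1) (c : ℝ) :
    pairExp r q κ p (fun _ _ => c) = c := by
  have h : ∀ x, ((numBlocks r q x : ℕ) : ℝ) ≠ 0 := fun x => Nat.cast_ne_zero.2 (Nat.succ_ne_zero _)
  simp only [pairExp, Finset.sum_const, Finset.card_range, nsmul_eq_mul, ← Finset.sum_mul, hκ,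
    one_mul]
  have h2 : ∀ x, 1 / 2 * ((numBlocks r q x : ℝ) * c / numBlocks r q x) + 1 / 2 * c = c :=
    fun x => by rw [mul_div_cancel_left₀ _ (h x)]; ring
  simp only [h2, ← Finset.sum_mul, hp, one_mul]

lemma pairExp_add (κ p : σ → ℝ) (φ ψ : σ → ℕ → ℝ) :
    pairExp r q κ p (fun y m => φ y m + ψ y m) = pairExp r q κ p φ + pairExp r q κ p ψ := by
  simp only [pairExp, Finset.sum_add_distrib, mul_add, add_div]
  ring

lemma pairExp_mul (κ p : σ → ℝ) (c : ℝ) (φ : σ → ℕ → ℝ) :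
    pairExp r q κ p (fun y m => c * φ y m) = c * pairExp r q κ p φ := by
  rw [pairExp, pairExp, Finset.mul_sum]
  refine Finset.sum_congr rfl fun x _ => ?_
  simp only [mul_left_comm _ c, ← Finset.mul_sum]
  ring

lemma pairExp_sum {ι : Type} (κ p : σ → ℝ) (s : Finset ι) (φ : ι → σ → ℕ → ℝ) :
    pairExp r q κ p (fun y m => ∑ i ∈ s, φ i y m) = ∑ i ∈ s, pairExp r q κ p (φ i) := by
  classical
  induction s using Finset.induction_on with
  | empty => simp [pairExp]
  | insert a s ha ih => simp only [Finset.sum_insert ha, pairExp_add, ih]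

/-- If `D y m` bounds the discrepancy of `p` and `q` on the pair of `y` and its `m`-th block, then
its expectation is bounded below by the total deviation. -/
lemma le_pairExp (hr : Function.Injective r) (hq : ∀ x, 0 ≤ q x)
    (hmono : ∀ x y, r x < r y → q x ≤ q y) {κ p : σ → ℝ} (hp : ∀ x, 0 ≤ p x) {γ L : ℝ}
    (hγ : 0 < γ) (hL : 1 ≤ L)
    (hκ : ∀ y, relWeight r γ q Finset.univ y / L ≤ κ y) {D : σ → ℕ → ℝ} (hD0 : ∀ y m, 0 ≤ D y m)
    (hD : ∀ y m, 0 < q y →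
      |p y * ∑ x ∈ block r q y m, q x - q y * ∑ x ∈ block r q y m, p x| ≤
        (p y + ∑ x ∈ block r q y m, p x) * (q y + ∑ x ∈ block r q y m, q x) * D y m) :
    (∑ y, deviation r γ p q Finset.univ y) / (6 * L) ≤ pairExp r q κ p D := by
  have hκ0 : ∀ y, 0 ≤ κ y := fun y =>
    (div_nonneg (relWeight_nonneg r hγ hq _ y) (by linarith)).trans (hκ y)
  -- Regroup the expectation by pairs. In the second kind of draw the sample may lie at or above
  -- `y`; those nonnegative terms are dropped.
  have h1 : ∑ y, ∑ m ∈ Finset.range (numBlocks r q y),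
      (1 / 2 * (p y / numBlocks r q y) + 1 / 2 * (κ y * ∑ x ∈ block r q y m, p x)) * D y m ≤
        pairExp r q κ p D := by
    have e1 : pairExp r q κ p D =
        ∑ y, ((∑ m ∈ Finset.range (numBlocks r q y), 1 / 2 * (p y / numBlocks r q y) * D y m) +
          1 / 2 * (κ y * ∑ x, p x * D y (blockIndex r q y x))) := by
      simp only [pairExp, mul_add, Finset.sum_add_distrib]
      congr 1
      · refine Finset.sum_congr rfl fun x _ => ?_
        rw [← Finset.mul_sum]; ring
      · simp only [Finset.mul_sum]
        rw [Finset.sum_comm]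
        exact Finset.sum_congr rfl fun x _ => Finset.sum_congr rfl fun y _ => by ring
    rw [e1]
    refine Finset.sum_le_sum fun y _ => ?_
    simp only [add_mul, Finset.sum_add_distrib]
    refine add_le_add le_rfl ?_
    have e2 : ∑ m ∈ Finset.range (numBlocks r q y),
        1 / 2 * (κ y * ∑ x ∈ block r q y m, p x) * D y m =
        1 / 2 * (κ y * ∑ x with r x < r y, p x * D y (blockIndex r q y x)) := by
      rw [sum_below_eq_sum_blocks hq, Finset.mul_sum, Finset.mul_sum]
      refine Finset.sum_congr rfl fun m _ => ?_
      rw [mul_assoc, mul_assoc, Finset.sum_mul]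
      congr 2
      refine Finset.sum_congr rfl fun x hx => ?_
      rw [(Finset.mem_filter.1 hx).2.2]
    rw [e2]
    refine mul_le_mul_of_nonneg_left (mul_le_mul_of_nonneg_left ?_ (hκ0 y)) (by norm_num)
    exact Finset.sum_le_sum_of_subset_of_nonneg (Finset.filter_subset _ _)
      fun x _ _ => mul_nonneg (hp x) (hD0 _ _)
  refine le_trans ?_ h1
  rw [Finset.sum_div]
  refine Finset.sum_le_sum fun y _ => ?_
  have hnn : ∀ m, 0 ≤ (1 / 2 * (p y / numBlocks r q y) +
      1 / 2 * (κ y * ∑ x ∈ block r q y m, p x)) * D y m := fun m => by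
    have := hp y
    have := hκ0 y
    have := hD0 y m
    have : 0 ≤ ∑ x ∈ block r q y m, p x := Finset.sum_nonneg fun x _ => hp x
    positivity
  rw [deviation]
  split_ifs with htop
  swap
  · rw [zero_div]; exact Finset.sum_nonneg fun m _ => hnn m
  set le := below r Finset.univ q y + q y with hle
  have hle0 : 0 < le := hγ.trans_le htop
  have hqy : 0 < q y := by
    rcases (hq y).eq_or_lt with h | h
    · have : below r Finset.univ q y = 0 := Finset.sum_eq_zero fun x hx =>
        le_antisymm (h ▸ hmono x y (Finset.mem_filter.1 hx).2) (hq x)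
      rw [hle, this, ← h] at hle0; linarith
    · exact h
  have hM0 : (0 : ℝ) < numBlocks r q y := Nat.cast_pos.2 (Nat.succ_pos _)
  have hM := numBlocks_mul_le (r := r) hq hqy
  have hκy : q y / le / L ≤ κ y := by
    have := hκ y; rwa [relWeight, if_pos htop] at this
  have hMy : q y / le / L ≤ 1 / numBlocks r q y := by
    calc q y / le / L ≤ q y / le := div_le_self (by positivity) hL
      _ ≤ _ := by rw [div_le_div_iff₀ hle0 hM0]; linarith
  -- A pair is drawn with probability at least (p y + pB)/2 · q y/(le · L), while its discrepancy is
  -- at most (p y + pB) · 3 q y · D. This gives the factor 6L; summing over blocks and the triangle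
  -- inequality recover the deviation of `y`.
  have hterm : ∀ m ∈ Finset.range (numBlocks r q y),
      |p y * ∑ x ∈ block r q y m, q x - q y * ∑ x ∈ block r q y m, p x| / le / (6 * L) ≤
      (1 / 2 * (p y / numBlocks r q y) + 1 / 2 * (κ y * ∑ x ∈ block r q y m, p x)) * D y m := by
    intro m _
    have hB := sum_block_le hr hq hmono hqy m
    have hDm := hD y m hqy
    set pB := ∑ x ∈ block r q y m, p x
    set qB := ∑ x ∈ block r q y m, q x
    have hpB : 0 ≤ pB := Finset.sum_nonneg fun x _ => hp x
    have hpy := hp y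
    have hDm0 := hD0 y m
    calc |p y * qB - q y * pB| / le / (6 * L) ≤
          (p y + pB) * (3 * q y) * D y m / le / (6 * L) := by
          refine div_le_div_of_nonneg_right (div_le_div_of_nonneg_right (hDm.trans ?_) hle0.le)
            (by linarith)
          refine mul_le_mul_of_nonneg_right (mul_le_mul_of_nonneg_left ?_ (by positivity)) hDm0
          linarith
      _ = (1 / 2 * (p y * (q y / le / L)) + 1 / 2 * (q y / le / L * pB)) * D y m := by
          field_simp; ring
      _ ≤ (1 / 2 * (p y * (1 / numBlocks r q y)) + 1 / 2 * (κ y * pB)) * D y m := by gcongr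
      _ = _ := by rw [mul_one_div]
  refine le_trans ?_ (Finset.sum_le_sum hterm)
  rw [← Finset.sum_div, ← Finset.sum_div]
  refine div_le_div_of_nonneg_right (div_le_div_of_nonneg_right ?_ hle0.le) (by linarith)
  refine le_trans (le_of_eq ?_) (Finset.abs_sum_le_sum_abs _ _)
  rw [Finset.sum_sub_distrib, ← Finset.mul_sum, ← Finset.mul_sum, ← sum_below_eq_sum_blocks hq,
    ← sum_below_eq_sum_blocks hq]
  rfl

end Blocks

lemma exists_rank {σ : Type} [Fintype σ] (q : σ → ℝ) :
    ∃ r : σ → ℕ, Function.Injective r ∧ ∀ x y, r x < r y → q x ≤ q y := by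
  let e := Fintype.equivFin σ
  let s := Tuple.sort (q ∘ e.symm)
  refine ⟨fun x => s.symm (e x), fun x y h => ?_, fun x y h => ?_⟩
  · exact e.injective (s.symm.injective (Fin.ext h))
  · have := Tuple.monotone_sort (q ∘ e.symm) (show s.symm (e x) ≤ s.symm (e y) from
      Fin.le_def.2 (le_of_lt h))
    simpa [s] using this

/-- The missing mass is spread according to `μ`. -/
lemma exists_pmf_ge {σ : Type} [Fintype σ] (μ : PMF σ) {w : σ → ℝ} (hw : ∀ x, 0 ≤ w x)
    (h : ∑ x, w x ≤ 1) : ∃ κ : PMF σ, ∀ x, w x ≤ (κ x).toReal := by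
  have hv : ∀ x, 0 ≤ w x + (1 - ∑ y, w y) * (μ x).toReal := fun x =>
    add_nonneg (hw x) (mul_nonneg (sub_nonneg.2 h) ENNReal.toReal_nonneg)
  refine ⟨PMF.ofFintype (fun x => ENNReal.ofReal (w x + (1 - ∑ y, w y) * (μ x).toReal)) ?_,
    fun x => ?_⟩
  · rw [← ENNReal.ofReal_sum_of_nonneg fun x _ => hv x, Finset.sum_add_distrib, ← Finset.mul_sum,
      PMF.sum_toReal]
    simp
  · rw [PMF.ofFintype_apply, ENNReal.toReal_ofReal (hv x)]
    have : 0 ≤ (1 - ∑ y, w y) * (μ x).toReal := mul_nonneg (sub_nonneg.2 h) ENNReal.toReal_nonneg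
    linarith

/-! ### Testing a single random pair -/

section PairTest

variable {σ : Type} [Fintype σ] (μ : PMF σ) (r : σ → ℕ)

open Classical in
/-- The query for `y` together with its `m`-th block. -/
noncomputable def pairQuery (y : σ) (m : ℕ) : CondQuery σ :=
  ⟨insert y (block r (fun x => (μ x).toReal) y m), Finset.insert_nonempty _ _⟩

open Classical in
/-- Compare the frequency of `y` in the conditional distribution on `y` and its `m`-th block with
its known value, up to an error `t`, using `K` samples. -/
noncomputable def pairTest (y : σ) (m : ℕ) (t : ℝ) (K : ℕ) : Prog (CondQuery σ) σ Bool :=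
  Prog.freqTest (.query (pairQuery μ r y m) fun x => .pure (decide (x = y)))
    (condOracle μ (pairQuery μ r y m) y).toReal t K

/-- The discrepancy of `ν` and `μ` on `y` and its `m`-th block. -/
noncomputable def pairDist (ν : PMF σ) (y : σ) (m : ℕ) : ℝ :=
  |(condOracle ν (pairQuery μ r y m) y).toReal - (condOracle μ (pairQuery μ r y m) y).toReal|

open Classical in
lemma acc_query_eq (ν : PMF σ) (Q : CondQuery σ) (y : σ) :
    Prog.acc (condOracle ν) (.query Q fun x => .pure (decide (x = y))) =
      (condOracle ν Q y).toReal := by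
  rw [Prog.acc_query, Finset.sum_eq_single_of_mem y (Finset.mem_univ y)]
  · simp
  · intro x _ hx; simp [hx]

lemma one_sub_acc_pairTest_le (y : σ) (m : ℕ) {t : ℝ} (K : ℕ) (ht0 : 0 ≤ t) (ht1 : t ≤ 1) :
    1 - Prog.acc (condOracle μ) (pairTest μ r y m t K) ≤ 2 * Real.exp (-(K * t ^ 2 / 4)) :=
  Prog.one_sub_acc_freqTest_le _ _ K ht0 ht1 (acc_query_eq _ _ _)

lemma acc_pairTest_le (ν : PMF σ) (y : σ) (m : ℕ) {t : ℝ} (K : ℕ) (ht0 : 0 ≤ t) (ht1 : t ≤ 1)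
    (h : 2 * t ≤ pairDist μ r ν y m) :
    Prog.acc (condOracle ν) (pairTest μ r y m t K) ≤ Real.exp (-(K * t ^ 2 / 4)) :=
  Prog.acc_freqTest_le _ _ K ht0 ht1 (by rw [acc_query_eq]; exact h)

lemma queriesAtMost_pairTest (y : σ) (m : ℕ) (t : ℝ) (K : ℕ) :
    (pairTest μ r y m t K).QueriesAtMost K := by
  have h : (Prog.query (R := σ) (pairQuery μ r y m)
      fun x => .pure (@decide (x = y) (Classical.propDecidable _))).QueriesAtMost 1 :=
    fun _ => trivial
  simpa [pairTest, Prog.freqTest] using h.tally _ K 0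

lemma pairDist_le_one (ν : PMF σ) (y : σ) (m : ℕ) : pairDist μ r ν y m ≤ 1 := by
  have h : ∀ κ : PMF σ, (κ y).toReal ≤ 1 := fun κ =>
    ENNReal.toReal_le_of_le_ofReal zero_le_one (by simpa using PMF.coe_le_one _ _)
  have h1 := h (condOracle ν (pairQuery μ r y m))
  have h2 := h (condOracle μ (pairQuery μ r y m))
  have h3 : 0 ≤ (condOracle ν (pairQuery μ r y m) y).toReal := ENNReal.toReal_nonneg
  have h4 : 0 ≤ (condOracle μ (pairQuery μ r y m) y).toReal := ENNReal.toReal_nonneg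
  rw [pairDist, abs_le]
  constructor <;> linarith

lemma sum_pairQuery (f : σ → ℝ) (y : σ) (m : ℕ) : ∑ x ∈ (pairQuery μ r y m).1, f x =
    f y + ∑ x ∈ block r (fun x => (μ x).toReal) y m, f x := by
  classical
  exact Finset.sum_insert (by simp [block])

lemma mem_pairQuery (y : σ) (m : ℕ) : y ∈ (pairQuery μ r y m).1 := by
  classical
  exact Finset.mem_insert_self _ _

/-- Clearing denominators in the difference of the two conditional probabilities gives equality when
ν charges the pair; otherwise the left side is zero. -/
lemma abs_sub_le_pairDist (ν : PMF σ) (y : σ) (m : ℕ) (hy : 0 < (μ y).toReal) :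
    |(ν y).toReal * ∑ x ∈ block r (fun x => (μ x).toReal) y m, (μ x).toReal -
        (μ y).toReal * ∑ x ∈ block r (fun x => (μ x).toReal) y m, (ν x).toReal| ≤
      ((ν y).toReal + ∑ x ∈ block r (fun x => (μ x).toReal) y m, (ν x).toReal) *
      ((μ y).toReal + ∑ x ∈ block r (fun x => (μ x).toReal) y m, (μ x).toReal) *
      pairDist μ r ν y m := by
  have hs := fun κ : PMF σ => sum_pairQuery μ r (fun x => (κ x).toReal) y m
  have h0 : ∀ κ : PMF σ, 0 ≤ ∑ x ∈ block r (fun x => (μ x).toReal) y m, (κ x).toReal :=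
    fun κ => Finset.sum_nonneg fun x _ => ENNReal.toReal_nonneg
  simp only [pairDist, condOracle, condDist_toReal, hs, if_pos (mem_pairQuery μ r y m)]
  have hν := h0 ν
  have hμ := h0 μ
  have hνy : 0 ≤ (ν y).toReal := ENNReal.toReal_nonneg
  set pB := ∑ x ∈ block r (fun x => (μ x).toReal) y m, (ν x).toReal
  set qB := ∑ x ∈ block r (fun x => (μ x).toReal) y m, (μ x).toReal
  rw [if_neg (show (μ y).toReal + qB ≠ 0 by linarith)]
  by_cases h : (ν y).toReal + pB = 0
  · have h1 : (ν y).toReal = 0 := by linarith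
    have h2 : pB = 0 := by linarith
    simp [h1, h2]
  · rw [if_neg h]
    have hp : 0 < (ν y).toReal + pB := lt_of_le_of_ne (by linarith) (Ne.symm h)
    have hq : 0 < (μ y).toReal + qB := by linarith
    refine le_of_eq ?_
    rw [← abs_of_pos (mul_pos hp hq), ← abs_mul]
    congr 1
    field_simp
    ring

instance (q : σ → ℝ) (y : σ) : NeZero (numBlocks r q y) := ⟨Nat.succ_ne_zero _⟩

/-- The query without a condition. -/
def univQuery (σ : Type) [Fintype σ] [Nonempty σ] : CondQuery σ :=
  ⟨Finset.univ, Finset.univ_nonempty⟩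

/-- Sample an element and test a random pair determined by it. -/
noncomputable def drawTest [Nonempty σ] (κ : PMF σ) (t : ℝ) (K : ℕ) : Prog (CondQuery σ) σ Bool :=
  .query (univQuery σ) fun x =>
    .sample (PMF.uniformOfFintype Bool) fun c =>
      if c then
        .sample (PMF.uniformOfFintype (Fin (numBlocks r (fun x => (μ x).toReal) x))) fun m =>
          pairTest μ r x m t K
      else .sample κ fun y => pairTest μ r y (blockIndex r (fun x => (μ x).toReal) y x) t K

lemma condOracle_univQuery [Nonempty σ] (ν : PMF σ) (x : σ) :
    (condOracle ν (univQuery σ) x).toReal = (ν x).toReal := by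
  refine (condDist_toReal ν Finset.univ Finset.univ_nonempty x).trans ?_
  rw [if_pos (Finset.mem_univ x), PMF.sum_toReal, if_neg one_ne_zero, div_one]

lemma acc_drawTest [Nonempty σ] (κ ν : PMF σ) (t : ℝ) (K : ℕ) :
    Prog.acc (condOracle ν) (drawTest μ r κ t K) =
      pairExp r (fun x => (μ x).toReal) (fun x => (κ x).toReal) (fun x => (ν x).toReal)
        fun y m => Prog.acc (condOracle ν) (pairTest μ r y m t K) := by
  rw [drawTest, Prog.acc_query, pairExp]
  refine Finset.sum_congr rfl fun x _ => ?_
  rw [condOracle_univQuery, Prog.acc_sample, Fintype.sum_bool, if_pos rfl, if_neg Bool.false_ne_true,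
    Prog.acc_sample, Prog.acc_sample, Finset.sum_range, div_eq_inv_mul (∑ _, _)]
  simp [Finset.mul_sum]

lemma queriesAtMost_drawTest [Nonempty σ] (κ : PMF σ) (t : ℝ) (K : ℕ) :
    (drawTest μ r κ t K).QueriesAtMost (K + 1) := by
  intro x c
  cases c
  · exact fun y => queriesAtMost_pairTest _ _ _ _ _ _
  · exact fun m => queriesAtMost_pairTest _ _ _ _ _ _

end PairTest

/-! ### Dyadic precisions and the level tester -/

lemma le_sum_dyadic {d : ℝ} (h1 : d ≤ 1) (J : ℕ) :
    d ≤ 1 / 2 ^ J + ∑ j ∈ Finset.range J, 1 / 2 ^ j * if 1 / 2 ^ (j + 1) ≤ d then 1 else 0 := by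
  induction J with
  | zero => simpa using h1
  | succ J ih =>
    rw [Finset.sum_range_succ]
    have hp : (0 : ℝ) < 1 / 2 ^ (J + 1) := by positivity
    split_ifs with h
    · linarith
    · have : 0 ≤ ∑ j ∈ Finset.range J, (1 / 2 ^ j * if 1 / 2 ^ (j + 1) ≤ d then 1 else 0 : ℝ) :=
        Finset.sum_nonneg fun j _ => by positivity
      linarith

/-- The lower bound makes the dyadic remainder 2^-J at most ρ/2; the upper bound controls the cost.
-/
lemma exists_two_pow_between {ρ : ℝ} (h0 : 0 < ρ) (h1 : ρ ≤ 1) :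
    ∃ J : ℕ, 2 / ρ ≤ 2 ^ J ∧ (2 : ℝ) ^ J ≤ 6 / ρ := by
  have h2 : 2 ≤ 2 / ρ := by rw [le_div_iff₀ h0]; linarith
  have hceil : 2 / ρ ≤ ⌈2 / ρ⌉₊ := Nat.le_ceil _
  have hceil' : (⌈2 / ρ⌉₊ : ℝ) < 2 / ρ + 1 := Nat.ceil_lt_add_one (by linarith)
  have hx : 1 < ⌈2 / ρ⌉₊ := by
    have : (1 : ℝ) < ⌈2 / ρ⌉₊ := by linarith
    exact_mod_cast this
  refine ⟨Nat.clog 2 ⌈2 / ρ⌉₊, hceil.trans (by exact_mod_cast Nat.le_pow_clog one_lt_two _), ?_⟩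
  have h3 := Nat.pow_pred_clog_lt_self one_lt_two hx
  have h4 : 0 < Nat.clog 2 ⌈2 / ρ⌉₊ := Nat.clog_pos one_lt_two hx
  have h5 : (2 : ℝ) ^ (Nat.clog 2 ⌈2 / ρ⌉₊).pred < ⌈2 / ρ⌉₊ := by exact_mod_cast h3
  have h6 : (2 : ℝ) ^ Nat.clog 2 ⌈2 / ρ⌉₊ = 2 * 2 ^ (Nat.clog 2 ⌈2 / ρ⌉₊).pred := by
    rw [← pow_succ', Nat.pred_eq_sub_one, Nat.sub_add_cancel h4]
  have h7 : 6 / ρ = 2 * (2 / ρ) + 2 / ρ := by ring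
  rw [h6]; linarith

section LevelTester

variable {σ : Type} [Fintype σ] [Nonempty σ] (μ κ : PMF σ) (r : σ → ℕ) (ρ : ℝ)

/-- The number of samples for a pair at a level. -/
noncomputable def levelSamples (j : ℕ) : ℕ := ⌈16 * 4 ^ j * Real.log (132 / ρ)⌉₊

/-- The number of pairs at a level. -/
noncomputable def levelReps (j : ℕ) : ℕ := ⌈16 / (2 ^ j * ρ)⌉₊

/-- Test random pairs with precisions `2⁻¹, …, 2⁻ᴶ`. -/
noncomputable def levelTester (J : ℕ) : Prog (CondQuery σ) σ Bool :=
  Prog.allAccept <| (List.range' 1 J).map fun j =>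
    Prog.allAccept <| List.replicate (levelReps ρ j) <|
      drawTest μ r κ (1 / 2 ^ (j + 1)) (levelSamples ρ j)

lemma queriesAtMost_levelTester (J : ℕ) : (levelTester μ κ r ρ J).QueriesAtMost
    (∑ j ∈ Finset.range J, levelReps ρ (j + 1) * (levelSamples ρ (j + 1) + 1)) := by
  rw [← List.sum_map_range' fun j => levelReps ρ j * (levelSamples ρ j + 1)]
  exact Prog.QueriesAtMost.allAccept_map fun j _ =>
    (queriesAtMost_drawTest μ r κ _ _).allAccept_replicate _

lemma acc_levelTester (ν : PMF σ) (J : ℕ) : Prog.acc (condOracle ν) (levelTester μ κ r ρ J) =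
    ∏ j ∈ Finset.range J, pairExp r (fun x => (μ x).toReal) (fun x => (κ x).toReal)
      (fun x => (ν x).toReal) (fun y m => Prog.acc (condOracle ν)
        (pairTest μ r y m (1 / 2 ^ (j + 1 + 1)) (levelSamples ρ (j + 1)))) ^
          levelReps ρ (j + 1) := by
  rw [levelTester, Prog.acc_allAccept, List.map_map, List.prod_map_range']
  refine Finset.prod_congr rfl fun j _ => ?_
  rw [Function.comp, Prog.acc_allAccept_replicate, acc_drawTest]

variable {ρ}

lemma half_pow_le_one (j : ℕ) : (1 / 2 ^ j : ℝ) ≤ 1 := by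
  rw [div_le_one (by positivity)]; exact one_le_pow₀ one_le_two

lemma two_mul_exp_levelSamples_le (h0 : 0 < ρ) (j : ℕ) :
    2 * Real.exp (-(levelSamples ρ j * (1 / 2 ^ (j + 1)) ^ 2 / 4)) ≤ ρ / 66 := by
  have h : Real.log (132 / ρ) ≤ levelSamples ρ j * (1 / 2 ^ (j + 1)) ^ 2 / 4 := by
    have : 16 * 4 ^ j * Real.log (132 / ρ) ≤ levelSamples ρ j := Nat.le_ceil _
    have e : (1 / 2 ^ (j + 1) : ℝ) ^ 2 / 4 = 1 / (16 * 4 ^ j) := by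
      rw [div_pow, ← pow_mul, show (4 : ℝ) = 2 ^ 2 by norm_num, ← pow_mul]
      field_simp; ring
    rw [mul_div_assoc, e, mul_one_div, le_div_iff₀ (by positivity)]
    linarith
  calc _ ≤ 2 * Real.exp (-Real.log (132 / ρ)) := by gcongr
    _ = ρ / 66 := by rw [Real.exp_neg, Real.exp_log (by positivity)]; field_simp; norm_num

lemma sum_levelReps_le (h0 : 0 < ρ) {J : ℕ} (hJ : (2 : ℝ) ^ J ≤ 6 / ρ) :
    ((∑ j ∈ Finset.range J, levelReps ρ (j + 1) : ℕ) : ℝ) ≤ 22 / ρ := by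
  have hterm : ∀ j, (levelReps ρ (j + 1) : ℝ) ≤ 16 / ρ * (1 / 2 ^ (j + 1)) + 1 := fun j => by
    refine (Nat.ceil_lt_add_one (by positivity)).le.trans (le_of_eq ?_)
    field_simp
  push_cast
  refine (Finset.sum_le_sum fun j _ => hterm j).trans ?_
  rw [Finset.sum_add_distrib, ← Finset.mul_sum]
  have h1 := mul_le_mul_of_nonneg_left (sum_inv_two_pow_le J) (by positivity : 0 ≤ 16 / ρ)
  have h2 : (J : ℝ) ≤ 2 ^ J := by exact_mod_cast (Nat.lt_two_pow_self (n := J)).le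
  have h3 : 22 / ρ = 16 / ρ + 6 / ρ := by ring
  simp only [Finset.sum_const, Finset.card_range, nsmul_eq_mul, mul_one]
  linarith

/-- At most 22/ρ pair tests are made, each failing with probability at most ρ/66; by Bernoulli's
inequality the total failure is at most 1/3. -/
lemma acc_levelTester_self (h0 : 0 < ρ) (h1 : ρ ≤ 1) {J : ℕ} (hJ : (2 : ℝ) ^ J ≤ 6 / ρ) :
    2 / 3 ≤ Prog.acc (condOracle μ) (levelTester μ κ r ρ J) := by
  have hb : 0 ≤ 1 - ρ / 66 := by linarith
  have hpow : 2 / 3 ≤ (1 - ρ / 66) ^ ∑ j ∈ Finset.range J, levelReps ρ (j + 1) := by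
    have b1 := one_add_mul_le_pow (show (-2 : ℝ) ≤ -(ρ / 66) by linarith)
      (∑ j ∈ Finset.range J, levelReps ρ (j + 1))
    have b2 := mul_le_mul_of_nonneg_right (sum_levelReps_le h0 hJ) (by positivity : 0 ≤ ρ / 66)
    have b3 : 22 / ρ * (ρ / 66) = 1 / 3 := by field_simp; norm_num
    rw [sub_eq_add_neg]
    linarith
  refine hpow.trans ?_
  rw [acc_levelTester, ← Finset.prod_pow_eq_pow_sum]
  refine Finset.prod_le_prod (fun j _ => pow_nonneg hb _) fun j _ => pow_le_pow_left₀ hb ?_ _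
  rw [← pairExp_const (r := r) (q := fun x => (μ x).toReal) (PMF.sum_toReal κ) (PMF.sum_toReal μ)
    (1 - ρ / 66)]
  refine pairExp_mono (fun _ => ENNReal.toReal_nonneg) (fun _ => ENNReal.toReal_nonneg)
    fun y m => ?_
  have b1 := one_sub_acc_pairTest_le μ r y m (levelSamples ρ (j + 1))
    (by positivity : (0 : ℝ) ≤ 1 / 2 ^ (j + 1 + 1)) (half_pow_le_one _)
  have b2 := two_mul_exp_levelSamples_le h0 (j + 1)
  linarith

lemma acc_levelTester_far (h0 : 0 < ρ) (h1 : ρ ≤ 1) {J : ℕ} (hJ : 2 / ρ ≤ (2 : ℝ) ^ J) (ν : PMF σ)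
    (hρ : ρ ≤ pairExp r (fun x => (μ x).toReal) (fun x => (κ x).toReal) (fun x => (ν x).toReal)
      (pairDist μ r ν)) :
    Prog.acc (condOracle ν) (levelTester μ κ r ρ J) ≤ 1 / 3 := by
  classical
  set E := pairExp r (fun x => (μ x).toReal) (fun x => (κ x).toReal) (fun x => (ν x).toReal) with hE
  have hmono : ∀ {φ ψ : σ → ℕ → ℝ}, (∀ y m, φ y m ≤ ψ y m) → E φ ≤ E ψ := fun h =>
    pairExp_mono (fun _ => ENNReal.toReal_nonneg) (fun _ => ENNReal.toReal_nonneg) h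
  have hconst : ∀ c, E (fun _ _ => c) = c := fun c =>
    pairExp_const (PMF.sum_toReal κ) (PMF.sum_toReal ν) c
  set ind : ℕ → σ → ℕ → ℝ := fun j y m => if 1 / 2 ^ (j + 1) ≤ pairDist μ r ν y m then 1 else 0
    with hind
  -- Half of the mean discrepancy survives the remainder and is spread over the levels, so the
  -- rejection exponents 4/ρ · 2^-j · E(ind j) add up to at least 2.
  have hsum : ρ / 2 ≤ ∑ j ∈ Finset.range J, 1 / 2 ^ j * E (ind j) := by
    have b1 : E (pairDist μ r ν) ≤
        E fun y m => 1 / 2 ^ J + ∑ j ∈ Finset.range J, 1 / 2 ^ j * ind j y m :=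
      hmono fun y m => le_sum_dyadic (pairDist_le_one μ r ν y m) J
    rw [hE, pairExp_add, pairExp_sum, ← hE, hconst] at b1
    simp only [hE, pairExp_mul] at b1
    have b2 : 1 / 2 ^ J ≤ ρ / 2 := by
      rw [div_le_div_iff₀ (by positivity) two_pos]
      rw [div_le_iff₀ h0] at hJ; linarith
    linarith
  have hacc0 : ∀ j, 0 ≤ E fun y m => Prog.acc (condOracle ν)
      (pairTest μ r y m (1 / 2 ^ (j + 1 + 1)) (levelSamples ρ (j + 1))) := fun j => by
    rw [← hconst 0]; exact hmono fun y m => Prog.acc_nonneg _ _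
  have hacc : ∀ j, (E fun y m => Prog.acc (condOracle ν)
      (pairTest μ r y m (1 / 2 ^ (j + 1 + 1)) (levelSamples ρ (j + 1)))) ≤
        Real.exp (-(1 / 2 * E (ind j))) := by
    intro j
    have b0 : (E fun y m => 1 + (-1 / 2) * ind j y m) = 1 - 1 / 2 * E (ind j) := by
      rw [hE, pairExp_add, pairExp_mul, ← hE, hconst]; ring
    have b1 := Real.add_one_le_exp (-(1 / 2 * E (ind j)))
    refine le_trans (hmono fun y m => ?_) (le_trans b0.le (by linarith))
    simp only [hind]
    split_ifs with h
    · have b2 := two_mul_exp_levelSamples_le h0 (j + 1)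
      have b3 := acc_pairTest_le μ r ν y m (t := 1 / 2 ^ (j + 1 + 1)) (levelSamples ρ (j + 1))
        (by positivity) (half_pow_le_one _)
        (le_trans (le_of_eq (by rw [pow_succ _ (j + 1)]; field_simp)) h)
      have b4 := (Real.exp_pos (-(levelSamples ρ (j + 1) * (1 / 2 ^ (j + 1 + 1)) ^ 2 / 4))).le
      linarith
    · simpa using Prog.acc_le_one _ _
  rw [acc_levelTester]
  calc _ ≤ ∏ j ∈ Finset.range J, Real.exp (-(4 / ρ * (1 / 2 ^ j * E (ind j)))) := by
        refine Finset.prod_le_prod (fun j _ => pow_nonneg (hacc0 j) _) fun j _ => ?_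
        refine (pow_le_pow_left₀ (hacc0 j) (hacc j) _).trans ?_
        rw [← Real.exp_nat_mul, Real.exp_le_exp]
        have b1 : 16 / (2 ^ (j + 1) * ρ) ≤ (levelReps ρ (j + 1) : ℝ) := Nat.le_ceil _
        have b2 : 0 ≤ E (ind j) := by
          rw [← hconst 0]; exact hmono fun y m => by simp only [hind]; split_ifs <;> norm_num
        have b3 : 4 / ρ * (1 / 2 ^ j * E (ind j)) =
            16 / (2 ^ (j + 1) * ρ) * (1 / 2 * E (ind j)) := by
          field_simp; ring
        rw [b3, mul_neg, neg_le_neg_iff]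
        gcongr
    _ ≤ Real.exp (-2) := by
        rw [← Real.exp_sum, Real.exp_le_exp, Finset.sum_neg_distrib, ← Finset.mul_sum,
          neg_le_neg_iff]
        have := mul_le_mul_of_nonneg_left hsum (by positivity : 0 ≤ 4 / ρ)
        refine le_trans (le_of_eq ?_) this
        field_simp; norm_num
    _ ≤ 1 / 3 := by
        rw [Real.exp_neg, inv_le_comm₀ (Real.exp_pos _) (by norm_num)]
        have := Real.add_one_le_exp (2 : ℝ)
        norm_num at this ⊢; linarith

lemma sum_level_queries_le (h0 : 0 < ρ) (h1 : ρ ≤ 1) {J : ℕ} (hJ : (2 : ℝ) ^ J ≤ 6 / ρ) :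
    ((∑ j ∈ Finset.range J, levelReps ρ (j + 1) * (levelSamples ρ (j + 1) + 1) : ℕ) : ℝ) ≤
      4752 * Real.log (132 / ρ) / ρ ^ 2 := by
  set l := Real.log (132 / ρ) with hl
  have hl1 : 1 ≤ l := by
    rw [hl, Real.le_log_iff_exp_le (by positivity), le_div_iff₀ h0]
    have := Real.exp_one_lt_d9
    nlinarith [Real.exp_pos 1]
  -- Few pairs need high precision: 1/(2^j ρ) pairs times 4^j samples grow like 2^j, so the last
  -- level, with 2^J of order 1/ρ, dominates.
  have hterm : ∀ j ∈ Finset.range J,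
      (levelReps ρ (j + 1) : ℝ) * (levelSamples ρ (j + 1) + 1) ≤ 396 * l / ρ * 2 ^ (j + 1) := by
    intro j hj
    have hjJ : (2 : ℝ) ^ (j + 1) ≤ 6 / ρ :=
      (pow_le_pow_right₀ one_le_two (Finset.mem_range.1 hj)).trans hJ
    have hR : (levelReps ρ (j + 1) : ℝ) ≤ 22 / (2 ^ (j + 1) * ρ) := by
      have b1 : (levelReps ρ (j + 1) : ℝ) ≤ 16 / (2 ^ (j + 1) * ρ) + 1 :=
        (Nat.ceil_lt_add_one (by positivity)).le
      have b2 : 1 ≤ 6 / (2 ^ (j + 1) * ρ) := by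
        rw [le_div_iff₀ h0] at hjJ
        rw [one_le_div (by positivity)]; exact hjJ
      have b3 : 22 / (2 ^ (j + 1) * ρ) = 16 / (2 ^ (j + 1) * ρ) + 6 / (2 ^ (j + 1) * ρ) := by ring
      linarith
    have hK : (levelSamples ρ (j + 1) : ℝ) + 1 ≤ 18 * 4 ^ (j + 1) * l := by
      have b1 : (levelSamples ρ (j + 1) : ℝ) ≤ 16 * 4 ^ (j + 1) * l + 1 :=
        (Nat.ceil_lt_add_one (by positivity)).le
      have b2 : (1 : ℝ) ≤ 4 ^ (j + 1) := one_le_pow₀ (by norm_num)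
      nlinarith
    calc _ ≤ 22 / (2 ^ (j + 1) * ρ) * (18 * 4 ^ (j + 1) * l) := by gcongr
      _ = _ := by
        rw [show (4 : ℝ) = 2 * 2 by norm_num, mul_pow]
        field_simp; ring
  push_cast
  refine (Finset.sum_le_sum hterm).trans ?_
  rw [← Finset.mul_sum]
  have hs : ∑ j ∈ Finset.range J, (2 : ℝ) ^ (j + 1) ≤ 12 / ρ := by
    refine (sum_two_pow_le J).trans ?_
    rw [pow_succ]
    have : 12 / ρ = 6 / ρ * 2 := by ring
    linarith
  refine (mul_le_mul_of_nonneg_left hs (by positivity)).trans (le_of_eq ?_)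
  field_simp; norm_num

end LevelTester

/-! ### Assembling the basic tester and amplifying its success probability -/

/-- A conditional identity tester with constant error probability. -/
lemma exists_weak_tester : ∃ A : ℝ, ∀ (σ : Type) [Fintype σ] (μ : PMF σ) (ε : ℝ), 0 < ε → ε < 1 →
    ∃ (P : Prog (CondQuery σ) σ Bool) (t : ℕ), P.QueriesAtMost t ∧
      (t : ℝ) ≤ A * (1 + Real.log (1 / ε)) ^ 3 / ε ^ 2 ∧
      2 / 3 ≤ Prog.acc (condOracle μ) P ∧
      ∀ ν : PMF σ, ε ≤ tvDist ν μ → Prog.acc (condOracle ν) P ≤ 1 / 3 := by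
  refine ⟨4752 * 6337 * 48 ^ 2, fun σ _ μ ε h0 h1 => ?_⟩
  have : Nonempty σ := ⟨μ.support_nonempty.some⟩
  classical
  have hlog := Real.log_nonneg (one_le_one_div h0 h1.le)
  set Λ := 1 + Real.log (1 / ε) with hΛ
  have hΛ1 : 1 ≤ Λ := by linarith
  -- With γ = ε/2 the total deviation is at least ε/4, and `le_pairExp` divides it by 6 · 2Λ.
  set ρ := ε / (48 * Λ) with hρ
  have hρ0 : 0 < ρ := by positivity
  have hρ1 : ρ ≤ 1 := by rw [hρ, div_le_one (by positivity)]; linarith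
  obtain ⟨r, hr, hmono⟩ := exists_rank fun x => (μ x).toReal
  have hμ0 : ∀ x, 0 ≤ (μ x).toReal := fun x => ENNReal.toReal_nonneg
  have hγ : 0 < ε / 2 := by positivity
  have hW : ∑ y, relWeight r (ε / 2) (fun x => (μ x).toReal) Finset.univ y ≤ 2 * Λ := by
    refine (sum_relWeight_le hr hγ hμ0 Finset.univ (by rw [PMF.sum_toReal]; linarith)).trans ?_
    rw [PMF.sum_toReal, show 1 / (ε / 2) = 2 * (1 / ε) by field_simp,
      Real.log_mul two_ne_zero (by positivity)]
    have := Real.log_two_lt_d9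
    linarith
  obtain ⟨κ, hκ⟩ := exists_pmf_ge μ
    (w := fun y => relWeight r (ε / 2) (fun x => (μ x).toReal) Finset.univ y / (2 * Λ))
    (fun y => div_nonneg (relWeight_nonneg r hγ hμ0 _ y) (by linarith))
    (by rw [← Finset.sum_div, div_le_one (by linarith)]; exact hW)
  obtain ⟨J, hJ1, hJ2⟩ := exists_two_pow_between hρ0 hρ1
  refine ⟨levelTester μ κ r ρ J, _, queriesAtMost_levelTester μ κ r ρ J, ?_,
    acc_levelTester_self μ κ r hρ0 hρ1 hJ2, fun ν hν =>
      acc_levelTester_far μ κ r hρ0 hρ1 hJ1 ν ?_⟩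
  · refine (sum_level_queries_le hρ0 hρ1 hJ2).trans ?_
    have hl : Real.log (132 / ρ) ≤ 6337 * Λ := by
      rw [show 132 / ρ = 6336 * Λ * (1 / ε) by rw [hρ]; field_simp; norm_num,
        Real.log_mul (by positivity) (by positivity), Real.log_mul (by positivity) (by positivity)]
      have b1 := Real.log_le_sub_one_of_pos (show (0 : ℝ) < 6336 by norm_num)
      have b2 := Real.log_le_sub_one_of_pos (show 0 < Λ by linarith)
      linarith
    calc _ ≤ 4752 * (6337 * Λ) / ρ ^ 2 := by gcongr
      _ = _ := by rw [hρ]; field_simp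
  · have hν0 : ∀ x, 0 ≤ (ν x).toReal := fun x => ENNReal.toReal_nonneg
    have hdev := sum_abs_sub_le_sum_deviation hr hγ hν0 hμ0 Finset.univ
      (by rw [PMF.sum_toReal]; linarith)
    simp only [PMF.sum_toReal, div_one, mul_one] at hdev
    rw [tvDist] at hν
    refine le_trans ?_ (le_pairExp hr hμ0 hmono hν0 hγ (show 1 ≤ 2 * Λ by linarith) hκ
      (fun y m => abs_nonneg _) fun y m hy => abs_sub_le_pairDist μ r ν y m hy)
    rw [hρ, div_le_div_iff₀ (by positivity) (by positivity)]
    nlinarith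

/-- Basic testers exist, with universal constants. -/
lemma exists_isBasicIDTester : ∃ (C : ℝ) (k : ℕ), ∀ (σ : Type) [Fintype σ],
    ∃ T : IDTesterFamily σ, IsBasicIDTester C k T := by
  obtain ⟨A, hA⟩ := exists_weak_tester
  refine ⟨144 * |A|, 3, fun σ _ => ?_⟩
  -- The range conditions are placed inside the existential so that choice yields a family on all
  -- parameters; outside the range any program will do.
  have key : ∀ (μ : PMF σ) (ε δ : ℝ), ∃ P : Prog (CondQuery σ) σ Bool,
      0 < ε → ε < 1 → 0 < δ → δ < 1 → IsCondIdentityTester μ ε δ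
      ⌊144 * |A| * ((1 + Real.log (1 / δ)) / ε ^ 2) *
        (1 + Real.log ((1 + Real.log (1 / δ)) / ε ^ 2)) ^ 3⌋₊ P := by
    intro μ ε δ
    by_cases h : 0 < ε ∧ ε < 1 ∧ 0 < δ ∧ δ < 1
    swap
    · exact ⟨.pure true, fun a b c d => absurd ⟨a, b, c, d⟩ h⟩
    obtain ⟨h0, h1, hd0, hd1⟩ := h
    obtain ⟨P, t, hPt, ht, hc, hs⟩ := hA σ μ ε h0 h1
    set K := ⌈144 * Real.log (1 / δ)⌉₊ with hK
    have hlδ := Real.log_nonneg (one_le_one_div hd0 hd1.le)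
    have hlε := Real.log_nonneg (one_le_one_div h0 h1.le)
    have hexp : Real.exp (-(K / 144 : ℝ)) ≤ δ := by
      have b1 : 144 * Real.log (1 / δ) ≤ K := Nat.le_ceil _
      rw [one_div, Real.log_inv] at b1
      rw [← Real.le_log_iff_exp_le hd0]
      linarith
    refine ⟨Prog.majority P K, fun _ _ _ _ => ⟨?_, ?_, ?_⟩⟩
    · refine (hPt.tally _ K 0).mono (Nat.le_floor ?_)
      have hKle : (K : ℝ) ≤ 144 * (1 + Real.log (1 / δ)) := by
        have : (K : ℝ) ≤ 144 * Real.log (1 / δ) + 1 := (Nat.ceil_lt_add_one (by positivity)).le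
        linarith
      -- This replaces powers of 1 + log(1/ε) by powers of 1 + log f.
      have hle : 1 / ε ≤ (1 + Real.log (1 / δ)) / ε ^ 2 := by
        rw [div_le_div_iff₀ h0 (by positivity)]
        nlinarith [mul_nonneg hlδ h0.le]
      have hlog : 1 + Real.log (1 / ε) ≤ 1 + Real.log ((1 + Real.log (1 / δ)) / ε ^ 2) :=
        add_le_add le_rfl (Real.log_le_log (by positivity) hle)
      push_cast
      calc (K : ℝ) * t ≤ 144 * (1 + Real.log (1 / δ)) *
            (|A| * (1 + Real.log (1 / ε)) ^ 3 / ε ^ 2) := by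
            refine mul_le_mul hKle (ht.trans ?_) (Nat.cast_nonneg _) (by positivity)
            gcongr
            exact le_abs_self A
        _ = 144 * |A| * ((1 + Real.log (1 / δ)) / ε ^ 2) * (1 + Real.log (1 / ε)) ^ 3 := by ring
        _ ≤ _ := by gcongr
    · rintro ν rfl
      have := Prog.one_sub_acc_majority_le _ P K hc
      change 1 - δ ≤ Prog.acc _ _
      linarith
    · intro ν hν
      have := Prog.acc_majority_le _ P K (hs ν (hν μ rfl))
      rw [Prog.run_false_eq]
      linarith
  choose T hT using key
  exact ⟨T, fun μ ε δ h0 h1 hd0 hd1 => hT μ ε δ h0 h1 hd0 hd1⟩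

theorem mainTheorem1 :
    (∃ (C : ℝ) (k : ℕ), ∀ (σ : Type) [Fintype σ], ∃ T : IDTesterFamily σ, IsBasicIDTester C k T) ∧
    ∀ (C : ℝ) (k : ℕ), ∃ (C' : ℝ) (k' : ℕ), ∀ (σ : Type) [Fintype σ] (T : IDTesterFamily σ),
      IsBasicIDTester C k T →
        ∀ (n : ℕ) [NeZero n] (ε : ℝ), 0 < ε → ε ≤ 1 → ∀ μ : PMF (Fin n → σ),
          IsSubCondIdentityTester μ ε (1 / 3)
            ⌊C' * ((n : ℝ) ^ 3 / ε ^ 3) * (1 + Real.log n + Real.log (1 / ε)) ^ k'⌋₊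
            (jointIdentityTester T μ ε) :=
  ⟨exists_isBasicIDTester, isSubCondIdentityTester_jointIdentityTester⟩
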